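/- Let $d\ge 1$, $n\ge 1$. A function $\psi:(\mathbb R^d)^n\to\mathbb C$ is anti-symmetric if $\psi(x_{\pi^{-1}(1)},\dots,x_{\pi^{-1}(n)})=(-1)^{\pi}\psi(x_1,\dots,x_n)$ for every permutation $\pi\in S_n$. It belongs to the Barron space if there is a finite Borel measure $\rho$ on triples $(a,b,\mathbf w)\in\mathbb C\times\mathbb R\times\mathbb R^{nd}$ (for instance one supported on real $a$) such that for every $\mathbf x\in\mathbb R^{nd}$ the following integral converges absolutely and $$\psi(\mathbf x)=\int a\,\max\{0,\mathbf w\cdot\mathbf x+b\}\,d\rho(a,b,\mathbf w).$$ The translation-invariant Barron norm $\|\psi\|_{\mathcal B}\in[0,\infty]$ is the infimum of $\int|a|\,\|\mathbf w\|_1\,d\rho(a,b,\mathbf w)$ over all such $\rho$, and the anti-symmetric Barron norm is $\|\psi\|_{\mathcal A}=\|\psi\|_{\mathcal B}/\sqrt{n!}$. For $w\in\mathbb R^d$ let $e_w(x)=e^{\mathrm i w\cdot x}$, and let $(\phi_1\wedge\dots\wedge\phi_n)(x_1,\dots,x_n)=\frac1{\sqrt{n!}}\det(\phi_j(x_i))_{i,j=1}^n$.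 **Theorem.** Let $C=2\sqrt d/\pi$. For each $d\ge1$ there is a function $g:\mathbb N\to\mathbb R$, depending only on $d$, with $g(n)=\Omega(n)$ (that is, there are $c>0$ and $n_0$ with $g(n)\ge cn$ for all $n\ge n_0$) such that the following holds for every $n\ge1$, every anti-symmetric $\psi:(\mathbb R^d)^n\to\mathbb C$ in the Barron space, and every integer $m\ge1$. There exist $\mu_1,\dots,\mu_m\in\mathbb C$ and $w_{kj}\in\mathbb R^d$ ($1\le k\le m$, $1\le j\le n$) such that $\psi_m=\frac1m\sum_{k=1}^m\mu_k\,(e_{w_{k1}}\wedge\dots\wedge e_{w_{kn}})$ satisfies $$\|\psi_m-\psi\|_{L^2(\mathbb R^{nd},\,\mathcal N(0,I_{nd}))}\le\frac{\|\psi\|_{\mathcal B}}{\sqrt{n!}}\Big(\frac{C}{\sqrt m}+2^{-g(n)}\Big)=\|\psi\|_{\mathcal A}\Big(\frac{C}{\sqrt m}+2^{-g(n)}\Big).$$ In particular $\psi_m$ has the form $\psi_m(\mathbf x)=\sum_{k=1}^m\det E_k(\mathbf x)$ with maps $E_k:(\mathbb R^d)^n\to\mathbb C^{n\times n}$ which are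 equivariant, i.e. permuting the particles $x_1,\dots,x_n$ by $\pi$ permutes the rows of $E_k(\mathbf x)$ by $\pi$. -/

import Mathlib

open MeasureTheory ProbabilityTheory Filter
open scoped ENNReal

noncomputable section

/-- Configurations `x = (x₁, …, xₙ)` of `n` particles in `ℝ^d`: `x i` is the position of the `i`-th
particle and `x i j` is its `j`-th coordinate. -/
abbrev Config (n d : ℕ) : Type := Fin n → Fin d → ℝ

/-- The action of a permutation on configurations,
`(x₁, …, xₙ) ↦ (x_{π⁻¹(1)}, …, x_{π⁻¹(n)})`. -/
def permConfig {n d : ℕ} (π : Equiv.Perm (Fin n)) (x : Config n d) : Config n d :=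
  fun i => x (π⁻¹ i)

/-- Anti-symmetry: `ψ(x_{π⁻¹(1)}, …, x_{π⁻¹(n)}) = (-1)^π ψ(x)` for all permutations `π`. -/
def IsAntisymmetric {n d : ℕ} (ψ : Config n d → ℂ) : Prop :=
  ∀ (π : Equiv.Perm (Fin n)) (x : Config n d),
    ψ (permConfig π x) = ((Equiv.Perm.sign π : ℤ) : ℂ) * ψ x

/-- The inner product `w · x` on `ℝ^{nd}`. -/
def configDot {n d : ℕ} (w x : Config n d) : ℝ := ∑ i, ∑ j, w i j * x i j

/-- The `ℓ¹` norm on `ℝ^{nd}`. -/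
def configNorm1 {n d : ℕ} (w : Config n d) : ℝ := ∑ i, ∑ j, |w i j|

/-- The ReLU activation function. -/
def relu (y : ℝ) : ℝ := max 0 y

/-- The neuron `x ↦ a · ReLU(w · x + b)` with parameters `p = (a, b, w)`.
The outer weight `a` may be complex (in particular it may be real). -/
def neuron {n d : ℕ} (p : ℂ × ℝ × Config n d) (x : Config n d) : ℂ :=
  p.1 * (relu (configDot p.2.2 x + p.2.1) : ℂ)

/-- `ρ` is a Barron measure for `f`: it is a finite measure on the parameters `(a, b, w)`, the
integral `∫ a ReLU(w · x + b) dρ(a, b, w)` converges for all `x`, and it equals `f x`. -/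
structure IsBarronMeasure {n d : ℕ} (ρ : Measure (ℂ × ℝ × Config n d)) (f : Config n d → ℂ) :
    Prop where
  finite : IsFiniteMeasure ρ
  integrable : ∀ x, Integrable (fun p => neuron p x) ρ
  eq_integral : ∀ x, f x = ∫ p, neuron p x ∂ρ

/-- Membership in the Barron space. -/
def IsBarron {n d : ℕ} (f : Config n d → ℂ) : Prop :=
  ∃ ρ : Measure (ℂ × ℝ × Config n d), IsBarronMeasure ρ f

/-- `φ(ρ) = ∫ |a| ‖w‖₁ dρ(a, b, w)`, a value in `[0, ∞]`. -/
def barronCost {n d : ℕ} (ρ : Measure (ℂ × ℝ × Config n d)) : ℝ≥0∞ :=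
  ∫⁻ p, ENNReal.ofReal (‖p.1‖ * configNorm1 p.2.2) ∂ρ

/-- The translation-invariant Barron norm, the infimum of `φ(ρ)` over the Barron measures `ρ`
for `f`. -/
def barronNorm {n d : ℕ} (f : Config n d → ℂ) : ℝ≥0∞ :=
  ⨅ (ρ : Measure (ℂ × ℝ × Config n d)) (_ : IsBarronMeasure ρ f), barronCost ρ

/-- The anti-symmetric Barron norm `‖ψ‖_B / √(n!)`. -/
def antisymBarronNorm {n d : ℕ} (ψ : Config n d → ℂ) : ℝ≥0∞ :=
  barronNorm ψ / ENNReal.ofReal (Real.sqrt (Nat.factorial n : ℝ))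

/-- The plane wave `e_w(x) = exp(i w · x)` on `ℝ^d`. -/
def planeWave {d : ℕ} (w x : Fin d → ℝ) : ℂ :=
  Complex.exp (Complex.I * ((∑ j, w j * x j : ℝ) : ℂ))

/-- The Slater determinant `(φ₁ ∧ ⋯ ∧ φₙ)(x) = (1/√(n!)) det (φ_j(x_i))_{ij}`. -/
def slater {n d : ℕ} (φ : Fin n → (Fin d → ℝ) → ℂ) (x : Config n d) : ℂ :=
  ((1 / Real.sqrt (Nat.factorial n : ℝ) : ℝ) : ℂ) *
    Matrix.det (Matrix.of fun i j => φ j (x i))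

/-- The combination `(1/m) ∑_{k=1}^m μ_k (e_{w_{k1}} ∧ ⋯ ∧ e_{w_{kn}})` of `m` plane-wave Slater
determinants. -/
def slaterSum {n d m : ℕ} (μ : Fin m → ℂ) (w : Fin m → Config n d) (x : Config n d) : ℂ :=
  (1 / (m : ℂ)) * ∑ k, μ k * slater (fun j => planeWave (w k j)) x

/-- `f` is a sum `∑_{k=1}^m det E_k(x)` with `E_k` equivariant: permuting the particles permutes
the rows of `E_k`. -/
def IsSumOfDets {n d : ℕ} (m : ℕ) (f : Config n d → ℂ) : Prop :=
  ∃ E : Fin m → Config n d → Matrix (Fin n) (Fin n) ℂ,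
    (∀ k (π : Equiv.Perm (Fin n)) x i j, E k (permConfig π x) i j = E k x (π⁻¹ i) j) ∧
    ∀ x, f x = ∑ k, Matrix.det (E k x)

/-- The standard Gaussian measure on `(ℝ^d)^n`. -/
def gaussianConfig (n d : ℕ) : Measure (Config n d) :=
  Measure.pi fun _ => Measure.pi fun _ => gaussianReal 0 1

end

/-! Write `ReLU(y) = (y + |y|) / 2` and `|y| = κ ∫ (1 - cos (s y)) / s² ds`. For `n ≥ 3`
antisymmetrization kills the constant and linear parts, so an antisymmetric Barron function becomes
a superposition, over neurons and frequencies `s`, of plane-wave Slater determinants with weight `1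
/ s²` (`sum_sign_mul_relu_eq_integral`, `IsAntisymmetric.eq_integral_slaterSample`). Monte Carlo
sampling from this superposition gives the rate `1 / √m` (`exists_weighted_sample_eLpNorm_le`).

The weight `1 / s²` has infinite mass near `0`, so the sampling density is the Cauchy profile `2 /
(R² + s²)`, and the factor `(R² + s²) / (2 s²)` goes into the samples. These have `L²` norm at most
`1`: for `|s| ≥ R` by Hadamard's inequality, and for `|s| ≤ R` because Slater determinants of slow
plane waves are tiny once `n` is large (`exists_forall_integral_norm_slater_planeWave_sq_le`). The
total mass is proportional to `1 / R`, so a large fixed `R` yields the required constant with no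
additional error term once `n ≥ n₀`.

Only finitely many `n < n₀` remain. There `g` may take any value, and the constant `ψ 0` is a
sufficient approximant because Barron functions are Lipschitz. -/

/-! ### AM–GM and Hadamard's inequality for positive semidefinite matrices -/

theorem Finset.prod_le_one_of_sum_le_card {ι : Type*} (s : Finset ι) (z : ι → ℝ)
    (hz : ∀ i ∈ s, 0 ≤ z i) (h : ∑ i ∈ s, z i ≤ s.card) : ∏ i ∈ s, z i ≤ 1 := by
  calc ∏ i ∈ s, z i ≤ ∏ i ∈ s, Real.exp (z i - 1) :=
        Finset.prod_le_prod hz fun i _ => by linarith [Real.add_one_le_exp (z i - 1)]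
    _ = Real.exp (∑ i ∈ s, (z i - 1)) := (Real.exp_sum _ _).symm
    _ ≤ 1 := by
        rw [Real.exp_le_one_iff, Finset.sum_sub_distrib]
        simpa using h

-- The eigenvalues are nonnegative and sum to the trace, which is the size of the matrix; AM–GM
-- bounds their product.
open scoped ComplexOrder in
theorem Matrix.PosSemidef.norm_det_le_one {ι : Type*} [Fintype ι] [DecidableEq ι]
    {A : Matrix ι ι ℂ} (hA : A.PosSemidef) (hdiag : ∀ i, A i i = 1) : ‖A.det‖ ≤ 1 := by
  have hsum : ∑ i, hA.isHermitian.eigenvalues i = Fintype.card ι := by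
    have h := hA.isHermitian.trace_eq_sum_eigenvalues
    simp only [Matrix.trace, Matrix.diag, hdiag] at h
    have h2 := congrArg Complex.re h
    simpa using h2.symm
  rw [hA.isHermitian.det_eq_prod_eigenvalues, norm_prod]
  refine (Finset.prod_le_one_of_sum_le_card _ _ (fun _ _ => norm_nonneg _) ?_)
  simp only [RCLike.norm_ofReal]
  rw [Finset.sum_congr rfl fun i _ => abs_of_nonneg (hA.eigenvalues_nonneg i), hsum]
  simp

/-! ### Integrals of squared determinants -/

section Determinants

variable {X : Type*} [MeasurableSpace X] {n : ℕ}

/-- Bounded measurable functions, indexed by a finite type. -/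
structure IsBoundedFamily {ι : Type*} (φ : ι → X → ℂ) : Prop where
  measurable : ∀ j, Measurable (φ j)
  bounded : ∀ j, ∃ K : ℝ, ∀ x, ‖φ j x‖ ≤ K

theorem IsBoundedFamily.integrable_conj_mul {ι : Type*} {φ : ι → X → ℂ} (h : IsBoundedFamily φ)
    (μ : Measure X) [IsFiniteMeasure μ] (j k : ι) :
    Integrable (fun x => (starRingEnd ℂ) (φ j x) * φ k x) μ := by
  obtain ⟨K, hK⟩ := h.bounded j
  obtain ⟨L, hL⟩ := h.bounded k
  refine Integrable.of_bound (C := K * L) ?_ ?_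
  · exact ((Complex.continuous_conj.measurable.comp (h.measurable j)).mul
      (h.measurable k)).aestronglyMeasurable
  · refine Eventually.of_forall fun x => ?_
    rw [norm_mul, RCLike.norm_conj]
    exact mul_le_mul (hK x) (hL x) (norm_nonneg _) ((norm_nonneg _).trans (hK x))

theorem IsBoundedFamily.integrable_norm_sq {ι : Type*} {φ : ι → X → ℂ} (h : IsBoundedFamily φ)
    (μ : Measure X) [IsFiniteMeasure μ] (j : ι) :
    Integrable (fun x => ‖φ j x‖ ^ 2) μ := by
  refine (h.integrable_conj_mul μ j j).norm.congr (Eventually.of_forall fun x => ?_)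
  simp [sq]

/-- The Gram matrix of a family of functions. -/
noncomputable def gramIntegral {ι : Type*} (μ : Measure X) (φ : ι → X → ℂ) : Matrix ι ι ℂ :=
  Matrix.of fun j k => ∫ x, (starRingEnd ℂ) (φ j x) * φ k x ∂μ

-- The quadratic form at `v` is the integral of `|∑ v_k φ_k|²`.
open scoped ComplexOrder in
theorem IsBoundedFamily.posSemidef_gramIntegral {ι : Type*} [Fintype ι] {φ : ι → X → ℂ}
    (h : IsBoundedFamily φ) (μ : Measure X) [IsFiniteMeasure μ] :
    (gramIntegral μ φ).PosSemidef := by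
  refine Matrix.PosSemidef.of_dotProduct_mulVec_nonneg ?_ fun v => ?_
  · ext j k
    simp only [Matrix.conjTranspose_apply, gramIntegral, Matrix.of_apply]
    rw [← starRingEnd_apply, ← integral_conj]
    congr 1 with x
    simp [mul_comm]
  · have key : star v ⬝ᵥ (gramIntegral μ φ).mulVec v =
        ((∫ x, ‖∑ k, v k * φ k x‖ ^ 2 ∂μ : ℝ) : ℂ) := by
      rw [← integral_complex_ofReal]
      have : ∀ x, (((‖∑ k, v k * φ k x‖ ^ 2 : ℝ)) : ℂ) =
          ∑ j, ∑ k, star (v j) * v k * ((starRingEnd ℂ) (φ j x) * φ k x) := by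
        intro x
        rw [Complex.ofReal_pow, ← Complex.conj_mul', map_sum, Finset.sum_mul_sum]
        refine Finset.sum_congr rfl fun j _ => Finset.sum_congr rfl fun k _ => ?_
        rw [map_mul, starRingEnd_apply (v j)]
        ring
      simp_rw [this]
      rw [integral_finsetSum _ fun j _ => integrable_finsetSum _ fun k _ =>
        (h.integrable_conj_mul μ j k).const_mul _]
      simp only [dotProduct, Matrix.mulVec, gramIntegral, Matrix.of_apply, Finset.mul_sum]
      refine Finset.sum_congr rfl fun j _ => ?_
      rw [integral_finsetSum _ fun k _ => (h.integrable_conj_mul μ j k).const_mul _]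
      refine Finset.sum_congr rfl fun k _ => ?_
      rw [integral_const_mul]
      simp only [Pi.star_apply]
      ring
    rw [key]
    exact_mod_cast integral_nonneg fun x => by positivity

/-- Andréief's identity. -/
theorem IsBoundedFamily.integral_conj_det_mul_det {φ : Fin n → X → ℂ} (h : IsBoundedFamily φ)
    (μ : Measure X) [IsFiniteMeasure μ] :
    ∫ x : Fin n → X, (starRingEnd ℂ) (Matrix.of fun i j => φ j (x i)).det *
      (Matrix.of fun i j => φ j (x i)).det ∂(Measure.pi fun _ => μ) =
      (n.factorial : ℂ) * (gramIntegral μ φ).det := by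
  have hexp : ∀ x : Fin n → X, (starRingEnd ℂ) (Matrix.of fun i j => φ j (x i)).det *
      (Matrix.of fun i j => φ j (x i)).det =
      ∑ σ : Equiv.Perm (Fin n), ∑ τ : Equiv.Perm (Fin n),
        ((Equiv.Perm.sign σ : ℤ) : ℂ) * ((Equiv.Perm.sign τ : ℤ) : ℂ) *
          ∏ i, ((starRingEnd ℂ) (φ (σ i) (x i)) * φ (τ i) (x i)) := by
    intro x
    rw [← Matrix.det_transpose, Matrix.det_apply', map_sum, Finset.sum_mul_sum]
    refine Finset.sum_congr rfl fun σ _ => Finset.sum_congr rfl fun τ _ => ?_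
    simp only [map_mul, map_prod, map_intCast, Matrix.transpose_apply, Matrix.of_apply,
      Finset.prod_mul_distrib]
    ring
  have hint : ∀ σ τ : Equiv.Perm (Fin n), Integrable (fun x : Fin n → X =>
      ((Equiv.Perm.sign σ : ℤ) : ℂ) * ((Equiv.Perm.sign τ : ℤ) : ℂ) *
          ∏ i, ((starRingEnd ℂ) (φ (σ i) (x i)) * φ (τ i) (x i))) (Measure.pi fun _ => μ) :=
    fun σ τ => (Integrable.fintype_prod
      (f := fun i y => (starRingEnd ℂ) (φ (σ i) y) * φ (τ i) y)
      fun i => h.integrable_conj_mul μ _ _).const_mul _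
  simp_rw [hexp]
  rw [integral_finsetSum _ fun σ _ => integrable_finsetSum _ fun τ _ => hint σ τ]
  have hσ : ∀ σ : Equiv.Perm (Fin n), ∫ x : Fin n → X, ∑ τ : Equiv.Perm (Fin n),
        ((Equiv.Perm.sign σ : ℤ) : ℂ) * ((Equiv.Perm.sign τ : ℤ) : ℂ) *
          ∏ i, ((starRingEnd ℂ) (φ (σ i) (x i)) * φ (τ i) (x i)) ∂(Measure.pi fun _ => μ) =
        (gramIntegral μ φ).det := by
    intro σ
    rw [integral_finsetSum _ fun τ _ => hint σ τ]
    -- For fixed `σ` the sum over `τ` is the determinant of the Gram matrix with rows permuted by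
    -- `σ`. The two signs cancel, so all `n!` choices of `σ` contribute equally.
    have h1 : ((gramIntegral μ φ).submatrix σ id).det =
        ((Equiv.Perm.sign σ : ℤ) : ℂ) * (gramIntegral μ φ).det := Matrix.det_permute _ _
    have h2 : ((Equiv.Perm.sign σ : ℤ) : ℂ) * ((Equiv.Perm.sign σ : ℤ) : ℂ) = 1 := by
      norm_cast
      simp
    calc _ = ((Equiv.Perm.sign σ : ℤ) : ℂ) * ((gramIntegral μ φ).submatrix σ id).det := by
          rw [← Matrix.det_transpose, Matrix.det_apply', Finset.mul_sum]
          refine Finset.sum_congr rfl fun τ _ => ?_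
          rw [integral_const_mul, integral_fintype_prod_eq_prod
            (f := fun i y => (starRingEnd ℂ) (φ (σ i) y) * φ (τ i) y)]
          simp [gramIntegral, mul_assoc]
      _ = _ := by rw [h1, ← mul_assoc, h2, one_mul]
  rw [Finset.sum_congr rfl fun σ _ => hσ σ]
  simp [Fintype.card_perm]

theorem IsBoundedFamily.integrable_norm_det_sq {φ : Fin n → X → ℂ} (h : IsBoundedFamily φ)
    (μ : Measure X) [IsFiniteMeasure μ] :
    Integrable (fun x : Fin n → X => ‖(Matrix.of fun i j => φ j (x i)).det‖ ^ 2)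
      (Measure.pi fun _ => μ) := by
  have hφ := h.measurable
  choose K hK using h.bounded
  have hdet : ∀ x : Fin n → X, ‖(Matrix.of fun i j => φ j (x i)).det‖ ≤
      ∑ σ : Equiv.Perm (Fin n), ∏ i, K i := by
    intro x
    rw [← Matrix.det_transpose, Matrix.det_apply']
    refine (norm_sum_le _ _).trans (Finset.sum_le_sum fun σ _ => ?_)
    rw [norm_mul, norm_prod, ← Equiv.prod_comp σ K]
    have : ‖((Equiv.Perm.sign σ : ℤ) : ℂ)‖ = 1 := by
      rcases Int.units_eq_one_or (Equiv.Perm.sign σ) with h | h <;> simp [h]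
    rw [this, one_mul]
    exact Finset.prod_le_prod (fun i _ => norm_nonneg _) fun i _ => hK (σ i) (x i)
  refine Integrable.of_bound (C := (∑ σ : Equiv.Perm (Fin n), ∏ i, K i) ^ 2) ?_ ?_
  · simp_rw [Matrix.det_apply']
    refine Measurable.aestronglyMeasurable ?_
    simp only [Matrix.of_apply]
    fun_prop
  · refine Eventually.of_forall fun x => ?_
    rw [Real.norm_of_nonneg (by positivity)]
    gcongr
    exact hdet x

/-- Hadamard's inequality for a family of functions of modulus one. -/
theorem integral_norm_det_sq_le_factorial {φ : Fin n → X → ℂ} (hm : ∀ j, Measurable (φ j))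
    (h1 : ∀ j x, ‖φ j x‖ = 1) (μ : Measure X) [IsProbabilityMeasure μ] :
    ∫ x : Fin n → X, ‖(Matrix.of fun i j => φ j (x i)).det‖ ^ 2 ∂(Measure.pi fun _ => μ) ≤
      n.factorial := by
  have hφ : IsBoundedFamily φ := ⟨hm, fun j => ⟨1, fun x => (h1 j x).le⟩⟩
  have key := hφ.integral_conj_det_mul_det μ
  simp_rw [Complex.conj_mul', ← Complex.ofReal_pow] at key
  rw [integral_complex_ofReal] at key
  have hdet : ‖(gramIntegral μ φ).det‖ ≤ 1 := by
    refine (hφ.posSemidef_gramIntegral μ).norm_det_le_one fun i => ?_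
    simp [gramIntegral, Complex.conj_mul', h1]
  have h0 : (0 : ℝ) ≤ ∫ x : Fin n → X, ‖(Matrix.of fun i j => φ j (x i)).det‖ ^ 2
      ∂(Measure.pi fun _ => μ) := integral_nonneg fun x => by positivity
  have := congrArg norm key
  rw [Complex.norm_real, Real.norm_of_nonneg h0, norm_mul, Complex.norm_natCast] at this
  rw [this]
  exact mul_le_of_le_one_right (by positivity) hdet

/-- Leibniz expansion and Cauchy–Schwarz over permutations. The loss of a factorial is affordable,
and the products on the right integrate one variable at a time. -/
theorem norm_det_sq_le {ι : Type*} [Fintype ι] [DecidableEq ι] (A : Matrix ι ι ℂ) :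
    ‖A.det‖ ^ 2 ≤ (Fintype.card ι).factorial *
      ∑ σ : Equiv.Perm ι, ∏ i, ‖A (σ i) i‖ ^ 2 := by
  have h1 : ‖A.det‖ ≤ ∑ σ : Equiv.Perm ι, ∏ i, ‖A (σ i) i‖ := by
    rw [Matrix.det_apply']
    refine (norm_sum_le _ _).trans (Finset.sum_le_sum fun σ _ => ?_)
    have : ‖((Equiv.Perm.sign σ : ℤ) : ℂ)‖ = 1 := by
      rcases Int.units_eq_one_or (Equiv.Perm.sign σ) with h | h <;> simp [h]
    rw [norm_mul, norm_prod, this, one_mul]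
  calc ‖A.det‖ ^ 2 ≤ (∑ σ : Equiv.Perm ι, ∏ i, ‖A (σ i) i‖) ^ 2 := by gcongr
    _ ≤ (Finset.univ : Finset (Equiv.Perm ι)).card *
        ∑ σ : Equiv.Perm ι, (∏ i, ‖A (σ i) i‖) ^ 2 := sq_sum_le_card_mul_sum_sq
    _ = _ := by simp_rw [← Finset.prod_pow, Finset.card_univ, Fintype.card_perm]

theorem IsBoundedFamily.integral_norm_det_sq_le {φ : Fin n → X → ℂ} (h : IsBoundedFamily φ)
    (μ : Measure X) [IsFiniteMeasure μ] :
    ∫ x : Fin n → X, ‖(Matrix.of fun i j => φ j (x i)).det‖ ^ 2 ∂(Measure.pi fun _ => μ) ≤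
      (n.factorial : ℝ) ^ 2 * ∏ j, ∫ x, ‖φ j x‖ ^ 2 ∂μ := by
  have hint : ∀ σ : Equiv.Perm (Fin n), Integrable (fun x : Fin n → X =>
      ∏ i, ‖φ (σ i) (x i)‖ ^ 2) (Measure.pi fun _ => μ) := fun σ =>
    Integrable.fintype_prod (f := fun i y => ‖φ (σ i) y‖ ^ 2)
      fun i => h.integrable_norm_sq μ (σ i)
  calc _ ≤ ∫ x : Fin n → X, (n.factorial : ℝ) *
        ∑ σ : Equiv.Perm (Fin n), ∏ i, ‖φ (σ i) (x i)‖ ^ 2 ∂(Measure.pi fun _ => μ) := by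
        refine integral_mono (h.integrable_norm_det_sq μ)
          ((integrable_finsetSum _ fun σ _ => hint σ).const_mul _) fun x => ?_
        have := norm_det_sq_le (Matrix.of fun i j => φ j (x i)).transpose
        simpa [Matrix.det_transpose] using this
    _ = _ := by
        rw [integral_const_mul, integral_finsetSum _ fun σ _ => hint σ]
        have : ∀ σ : Equiv.Perm (Fin n), ∫ x : Fin n → X, ∏ i, ‖φ (σ i) (x i)‖ ^ 2
            ∂(Measure.pi fun _ => μ) = ∏ j, ∫ x, ‖φ j x‖ ^ 2 ∂μ := by
          intro σ
          rw [integral_fintype_prod_eq_prod (f := fun i y => ‖φ (σ i) y‖ ^ 2)]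
          exact Equiv.prod_comp σ fun j => ∫ x, ‖φ j x‖ ^ 2 ∂μ
        rw [Finset.sum_congr rfl fun σ _ => this σ]
        simp [Fintype.card_perm]
        ring

end Determinants

/-! ### The absolute value as an integral of cosines -/

theorem one_sub_cos_div_sq_le (s : ℝ) : (1 - Real.cos s) / s ^ 2 ≤ 4 * (1 + s ^ 2)⁻¹ := by
  rcases eq_or_ne s 0 with rfl | hs
  · norm_num
  · have hs2 : 0 < s ^ 2 := by positivity
    rw [div_le_iff₀ hs2, mul_assoc, inv_mul_eq_div, mul_div_assoc', le_div_iff₀ (by positivity)]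
    have h1 := Real.one_sub_sq_div_two_le_cos (x := s)
    have h2 := Real.neg_one_le_cos s
    have h3 := Real.cos_le_one s
    nlinarith

theorem integrable_one_sub_cos_div_sq :
    Integrable fun s : ℝ => (1 - Real.cos s) / s ^ 2 := by
  refine Integrable.mono' (integrable_inv_one_add_sq.const_mul 4) ?_ ?_
  · exact Measurable.aestronglyMeasurable (by fun_prop)
  · refine Eventually.of_forall fun s => ?_
    rw [Real.norm_of_nonneg (div_nonneg (by linarith [Real.cos_le_one s]) (by positivity))]
    exact one_sub_cos_div_sq_le s

theorem integrable_one_sub_cos_mul_div_sq (y : ℝ) :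
    Integrable fun s : ℝ => (1 - Real.cos (s * y)) / s ^ 2 := by
  rcases eq_or_ne y 0 with rfl | hy
  · simp
  · refine ((integrable_one_sub_cos_div_sq.comp_mul_right' hy).const_mul (y ^ 2)).congr
      (Eventually.of_forall fun s => ?_)
    rcases eq_or_ne s 0 with rfl | hs
    · simp
    · simp only
      field_simp

theorem integral_one_sub_cos_div_sq_pos : 0 < ∫ s : ℝ, (1 - Real.cos s) / s ^ 2 := by
  rw [integral_pos_iff_support_of_nonneg (fun s => div_nonneg (by linarith [Real.cos_le_one s])
    (by positivity)) integrable_one_sub_cos_div_sq]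
  refine lt_of_lt_of_le ?_ (measure_mono (s := Set.Ioo 0 1) fun s hs => ?_)
  · simp
  · have : Real.cos s < 1 := by
      have := Real.cos_lt_cos_of_nonneg_of_le_pi le_rfl
        (by linarith [hs.2, Real.pi_gt_three] : s ≤ Real.pi) hs.1
      simpa using this
    exact (div_pos (by linarith) (pow_pos hs.1 2)).ne'

/-- Substitution `s ↦ s y`: the integrand scales by `y²` and the measure by `1 / |y|`. -/
theorem integral_one_sub_cos_mul_div_sq (y : ℝ) :
    ∫ s : ℝ, (1 - Real.cos (s * y)) / s ^ 2 =
      |y| * ∫ s : ℝ, (1 - Real.cos s) / s ^ 2 := by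
  rcases eq_or_ne y 0 with rfl | hy
  · simp
  · have h := Measure.integral_comp_mul_right (fun s => (1 - Real.cos s) / s ^ 2) y
    have h2 : ∀ s : ℝ, (1 - Real.cos (s * y)) / s ^ 2 =
        y ^ 2 * ((1 - Real.cos (s * y)) / (s * y) ^ 2) := by
      intro s
      rcases eq_or_ne s 0 with rfl | hs
      · simp
      · field_simp
    simp_rw [h2]
    rw [integral_const_mul, h, smul_eq_mul, ← mul_assoc, abs_inv, ← sq_abs y]
    have : |y| ≠ 0 := abs_ne_zero.mpr hy
    field_simp

/-- The absolute value as a superposition of cosines. -/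
theorem exists_abs_eq_integral_cos : ∃ κ : ℝ, 0 < κ ∧ ∀ y : ℝ,
    |y| = κ * ∫ s : ℝ, (1 - Real.cos (s * y)) / s ^ 2 := by
  -- `κ` is the inverse of the integral at `y = 1`. Its numerical value is never needed, since the
  -- later choice of `R` absorbs it.
  refine ⟨_, inv_pos.mpr integral_one_sub_cos_div_sq_pos, fun y => ?_⟩
  rw [integral_one_sub_cos_mul_div_sq]
  have := integral_one_sub_cos_div_sq_pos.ne'
  field_simp

/-! ### Derandomized Monte Carlo sampling -/

section Sampling

variable {Ω X : Type*} [MeasurableSpace Ω] [MeasurableSpace X]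

/-- The centred variable is orthogonal to constants, and a variance is at most the second moment.
This is the gain from adding one more sample to an accumulated error `z`. -/
theorem lintegral_enorm_add_sub_mean_sq_le (ν : Measure Ω) [IsProbabilityMeasure ν] {h : Ω → ℂ}
    (hh : Integrable h ν) (z : ℂ) :
    ∫⁻ ω, ‖z + (h ω - ∫ η, h η ∂ν)‖ₑ ^ 2 ∂ν ≤ ‖z‖ₑ ^ 2 + ∫⁻ ω, ‖h ω‖ₑ ^ 2 ∂ν := by
  by_cases hfin : ∫⁻ ω, ‖h ω‖ₑ ^ 2 ∂ν = ∞
  · simp [hfin]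
  set f := ∫ η, h η ∂ν with hf
  have hsq : Integrable (fun ω => ‖h ω‖ ^ 2) ν := by
    refine ⟨(hh.aestronglyMeasurable.norm.pow 2), ?_⟩
    simpa [HasFiniteIntegral, enorm_pow, enorm_norm] using lt_top_iff_ne_top.mpr hfin
  have hpt : ∀ ω, ‖z + (h ω - f)‖ ^ 2 =
      ‖z - f‖ ^ 2 + 2 * ((starRingEnd ℂ) (z - f) * h ω).re + ‖h ω‖ ^ 2 := by
    intro ω
    simp only [← Complex.normSq_eq_norm_sq, Complex.normSq_apply, Complex.add_re, Complex.sub_re,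
      Complex.add_im, Complex.sub_im, Complex.mul_re, Complex.conj_re, Complex.conj_im]
    ring
  have hre : Integrable (fun ω => ((starRingEnd ℂ) (z - f) * h ω).re) ν :=
    (hh.const_mul _).re
  have hint : Integrable (fun ω => ‖z + (h ω - f)‖ ^ 2) ν := by
    simp_rw [hpt]
    exact ((integrable_const _).add (hre.const_mul 2)).add hsq
  have hval : ∫ ω, ‖z + (h ω - f)‖ ^ 2 ∂ν ≤ ‖z‖ ^ 2 + ∫ ω, ‖h ω‖ ^ 2 ∂ν := by
    have hsplit : ∫ ω, (‖z - f‖ ^ 2 + 2 * ((starRingEnd ℂ) (z - f) * h ω).re + ‖h ω‖ ^ 2) ∂ν =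
        ∫ _, ‖z - f‖ ^ 2 ∂ν + 2 * ∫ ω, ((starRingEnd ℂ) (z - f) * h ω).re ∂ν +
          ∫ ω, ‖h ω‖ ^ 2 ∂ν := by
      rw [← integral_const_mul, ← integral_add (integrable_const _) (hre.const_mul 2)]
      exact integral_add ((integrable_const _).add (hre.const_mul 2)) hsq
    simp_rw [hpt]
    rw [hsplit]
    have : ∫ ω, ((starRingEnd ℂ) (z - f) * h ω).re ∂ν = ((starRingEnd ℂ) (z - f) * f).re := by
      rw [← integral_const_mul]
      exact integral_re (hh.const_mul ((starRingEnd ℂ) (z - f)))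
    rw [this, integral_const, probReal_univ, one_smul]
    simp only [← Complex.normSq_eq_norm_sq, Complex.normSq_apply, Complex.sub_re,
      Complex.sub_im, Complex.mul_re, Complex.conj_re, Complex.conj_im]
    nlinarith [mul_self_nonneg f.re, mul_self_nonneg f.im]
  have conv : ∀ u : Ω → ℂ, Integrable (fun ω => ‖u ω‖ ^ 2) ν →
      ∫⁻ ω, ‖u ω‖ₑ ^ 2 ∂ν = ENNReal.ofReal (∫ ω, ‖u ω‖ ^ 2 ∂ν) := by
    intro u hu
    rw [ofReal_integral_eq_lintegral_ofReal hu (Eventually.of_forall fun _ => by positivity)]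
    simp_rw [ENNReal.ofReal_pow (norm_nonneg _), ofReal_norm]
  rw [conv _ hint, conv _ hsq, ← ofReal_norm, ← ENNReal.ofReal_pow (norm_nonneg _),
    ← ENNReal.ofReal_add (by positivity) (integral_nonneg fun _ => by positivity)]
  exact ENNReal.ofReal_le_ofReal hval

/-- Greedy selection of sample points with the Monte Carlo error bound. -/
theorem exists_sample_lintegral_sum_le (ν : Measure Ω) [IsProbabilityMeasure ν]
    (γ : Measure X) [SFinite γ] {h : Ω → X → ℂ} (hm : Measurable (Function.uncurry h))
    (hint : ∀ x, Integrable (fun ω => h ω x) ν) (M : ℝ≥0∞)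
    (hM : ∀ᵐ ω ∂ν, ∫⁻ x, ‖h ω x‖ₑ ^ 2 ∂γ ≤ M) (m : ℕ) :
    ∃ ω : Fin m → Ω,
      ∫⁻ x, ‖∑ k, (h (ω k) x - ∫ η, h η x ∂ν)‖ₑ ^ 2 ∂γ ≤ m * M := by
  have hf : Measurable fun x => ∫ η, h η x ∂ν :=
    (StronglyMeasurable.integral_prod_left (μ := ν) (f := fun ω x => h ω x)
      hm.stronglyMeasurable).measurable
  have hmω : ∀ ω, Measurable (h ω) := fun ω => hm.of_uncurry_left
  induction m with
  | zero => exact ⟨Fin.elim0, by simp⟩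
  | succ m ih =>
    obtain ⟨ω, hω⟩ := ih
    set S : X → ℂ := fun x => ∑ k, (h (ω k) x - ∫ η, h η x ∂ν) with hS
    have hSm : Measurable S := Finset.measurable_fun_sum _ fun k _ => (hmω _).sub hf
    have hJm : Measurable fun p : Ω × X => ‖S p.2 + (h p.1 p.2 - ∫ η, h η p.2 ∂ν)‖ₑ ^ 2 :=
      (((hSm.comp measurable_snd).add (hm.sub (hf.comp measurable_snd))).enorm).pow_const 2
    -- Averaged over the next sample, the squared error grows by at most `M`, by Tonelli and the
    -- pointwise variance bound; some sample does no worse than the average.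
    have havg : ∫⁻ η, ∫⁻ x, ‖S x + (h η x - ∫ η, h η x ∂ν)‖ₑ ^ 2 ∂γ ∂ν ≤ (m + 1) * M := by
      rw [lintegral_lintegral_swap hJm.aemeasurable]
      calc _ ≤ ∫⁻ x, (‖S x‖ₑ ^ 2 + ∫⁻ η, ‖h η x‖ₑ ^ 2 ∂ν) ∂γ :=
            lintegral_mono fun x => lintegral_enorm_add_sub_mean_sq_le ν (hint x) (S x)
        _ = ∫⁻ x, ‖S x‖ₑ ^ 2 ∂γ + ∫⁻ x, ∫⁻ η, ‖h η x‖ₑ ^ 2 ∂ν ∂γ :=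
            lintegral_add_left (hSm.enorm.pow_const 2) _
        _ ≤ m * M + M := by
            refine add_le_add hω ?_
            rw [← lintegral_lintegral_swap (hm.enorm.pow_const 2).aemeasurable]
            calc _ ≤ ∫⁻ _, M ∂ν := lintegral_mono_ae hM
              _ = M := by simp
        _ = _ := by rw [add_mul, one_mul]
    obtain ⟨η, hη⟩ := exists_le_lintegral (μ := ν)
      (f := fun η => ∫⁻ x, ‖S x + (h η x - ∫ η, h η x ∂ν)‖ₑ ^ 2 ∂γ)
      (hJm.lintegral_prod_right' (ν := γ)).aemeasurable
    refine ⟨Fin.snoc ω η, ?_⟩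
    push_cast
    refine le_trans (le_of_eq ?_) (hη.trans havg)
    simp only [Fin.sum_univ_castSucc, Fin.snoc_castSucc, Fin.snoc_last, hS]

/-- Monte Carlo approximation with importance weights `β`. -/
theorem exists_weighted_sample_eLpNorm_le (ν : Measure Ω) [SFinite ν]
    (γ : Measure X) [SFinite γ] {β : Ω → ℝ} (hβm : Measurable β) (hβ0 : ∀ ω, 0 ≤ β ω)
    (hβ : Integrable β ν) (hW : 0 < ∫ ω, β ω ∂ν)
    {h : Ω → X → ℂ} (hm : Measurable (Function.uncurry h))
    (hint : ∀ x, Integrable (fun ω => β ω * h ω x) ν)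
    (hM : ∀ ω, ∫⁻ x, ‖h ω x‖ₑ ^ 2 ∂γ ≤ 1) (m : ℕ) (hm1 : 1 ≤ m) :
    ∃ ω : Fin m → Ω,
      eLpNorm (fun x => 1 / (m : ℂ) * ∑ k, ((∫ η, β η ∂ν : ℝ) : ℂ) * h (ω k) x -
        ∫ η, β η * h η x ∂ν) 2 γ ≤ ENNReal.ofReal ((∫ η, β η ∂ν) / Real.sqrt m) := by
  set W := ∫ η, β η ∂ν with hWdef
  have hWC : (W : ℂ) ≠ 0 := by exact_mod_cast hW.ne'
  have hmC : (m : ℂ) ≠ 0 := by exact_mod_cast (by omega : m ≠ 0)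
  -- Normalizing `β` to a probability density makes `W * h` an unbiased estimator of the weighted
  -- integral.
  set p : Ω → NNReal := fun ω => (β ω / W).toNNReal with hp
  have hpm : Measurable p := (hβm.div_const W).real_toNNReal
  have hpval : ∀ ω, ((p ω : ℝ)) = β ω / W := fun ω =>
    Real.coe_toNNReal _ (div_nonneg (hβ0 ω) hW.le)
  set ν' := ν.withDensity fun ω => (p ω : ℝ≥0∞) with hν'
  have hprob : IsProbabilityMeasure ν' := by
    refine ⟨?_⟩
    rw [hν', withDensity_apply _ MeasurableSet.univ, Measure.restrict_univ]
    have : ∀ ω, (p ω : ℝ≥0∞) = ENNReal.ofReal (β ω / W) := fun ω => rfl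
    simp_rw [this]
    rw [← ofReal_integral_eq_lintegral_ofReal (hβ.div_const W)
      (Eventually.of_forall fun ω => div_nonneg (hβ0 ω) hW.le), integral_div, ← hWdef,
      div_self hW.ne', ENNReal.ofReal_one]
  have hint' : ∀ x, Integrable (fun ω => h ω x) ν' := by
    intro x
    rw [hν', integrable_withDensity_iff_integrable_smul hpm]
    refine ((hint x).const_mul (W⁻¹ : ℂ)).congr (Eventually.of_forall fun ω => ?_)
    simp only
    rw [NNReal.smul_def, hpval, Complex.real_smul]
    push_cast
    ring
  have hmean : ∀ x, ∫ η, h η x ∂ν' = (W⁻¹ : ℂ) * ∫ η, β η * h η x ∂ν := by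
    intro x
    rw [hν', integral_withDensity_eq_integral_smul hpm, ← integral_const_mul]
    refine integral_congr_ae (Eventually.of_forall fun ω => ?_)
    simp only
    rw [NNReal.smul_def, hpval, Complex.real_smul]
    push_cast
    ring
  obtain ⟨ω, hω⟩ := exists_sample_lintegral_sum_le ν' γ hm hint' 1 (Eventually.of_forall hM) m
  refine ⟨ω, ?_⟩
  have hpt : ∀ x, 1 / (m : ℂ) * ∑ k, (W : ℂ) * h (ω k) x - ∫ η, β η * h η x ∂ν =
      ((W / m : ℝ) : ℂ) * ∑ k, (h (ω k) x - ∫ η, h η x ∂ν') := by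
    intro x
    rw [Finset.sum_sub_distrib, hmean, ← Finset.mul_sum]
    simp only [Finset.sum_const, Finset.card_univ, Fintype.card_fin, nsmul_eq_mul]
    push_cast
    field_simp
  simp_rw [hpt]
  have hsum : eLpNorm (fun x => ∑ k, (h (ω k) x - ∫ η, h η x ∂ν')) 2 γ ≤
      ENNReal.ofReal (Real.sqrt m) := by
    rw [eLpNorm_eq_lintegral_rpow_enorm_toReal two_ne_zero ENNReal.ofNat_ne_top]
    simp only [ENNReal.toReal_ofNat, ENNReal.rpow_ofNat]
    rw [mul_one] at hω
    calc _ ≤ ((m : ℝ≥0∞)) ^ ((1 : ℝ) / 2) := ENNReal.rpow_le_rpow hω (by norm_num)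
      _ = _ := by
        rw [Real.sqrt_eq_rpow, ← ENNReal.ofReal_rpow_of_nonneg (by positivity) (by norm_num),
          ENNReal.ofReal_natCast]
  calc _ = ‖((W / m : ℝ) : ℂ)‖ₑ *
        eLpNorm (fun x => ∑ k, (h (ω k) x - ∫ η, h η x ∂ν')) 2 γ :=
        eLpNorm_const_smul _ _ _ _
    _ ≤ ENNReal.ofReal (W / m) * ENNReal.ofReal (Real.sqrt m) := by
        refine mul_le_mul' (le_of_eq ?_) hsum
        rw [← ofReal_norm, Complex.norm_real, Real.norm_of_nonneg (by positivity)]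
    _ = _ := by
        rw [← ENNReal.ofReal_mul (by positivity)]
        congr 1
        have : (0 : ℝ) < m := by exact_mod_cast hm1
        rw [div_mul_eq_mul_div, div_eq_div_iff this.ne' (by positivity), mul_assoc,
          Real.mul_self_sqrt this.le]

end Sampling

/-! ### Plane-wave Slater determinants under the Gaussian measure -/

section PlaneWaves

variable {n d : ℕ}

theorem abs_dot_le (w x : Fin d → ℝ) : |∑ j, w j * x j| ≤ (∑ j, |w j|) * ‖x‖ := by
  rw [Finset.sum_mul]
  refine (Finset.abs_sum_le_sum_abs _ _).trans (Finset.sum_le_sum fun j _ => ?_)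
  rw [abs_mul]
  exact mul_le_mul_of_nonneg_left (norm_le_pi_norm x j) (abs_nonneg _)

theorem norm_planeWave (w x : Fin d → ℝ) : ‖planeWave w x‖ = 1 :=
  Complex.norm_exp_I_mul_ofReal _

theorem measurable_planeWave_uncurry :
    Measurable fun p : (Fin d → ℝ) × (Fin d → ℝ) => planeWave p.1 p.2 := by
  unfold planeWave
  fun_prop

theorem measurable_planeWave (w : Fin d → ℝ) : Measurable (planeWave w) :=
  measurable_planeWave_uncurry.comp measurable_prodMk_left

/-- Factor out `e_v`, which has modulus one, and use `|e^{it} - 1| ≤ |t|`. -/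
theorem norm_planeWave_sub_le (w v x : Fin d → ℝ) :
    ‖planeWave w x - planeWave v x‖ ≤ (∑ j, |w j - v j|) * ‖x‖ := by
  have h : planeWave w x - planeWave v x =
      planeWave v x * (Complex.exp (Complex.I * ((∑ j, (w j - v j) * x j : ℝ) : ℂ)) - 1) := by
    unfold planeWave
    rw [mul_sub, ← Complex.exp_add, mul_one]
    congr 2
    simp_rw [sub_mul, Finset.sum_sub_distrib]
    push_cast
    ring
  rw [h, norm_mul, norm_planeWave, one_mul]
  exact Real.norm_exp_I_mul_ofReal_sub_one_le.trans (abs_dot_le _ _)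

theorem configNorm1_nonneg (w : Config n d) : 0 ≤ configNorm1 w :=
  Finset.sum_nonneg fun _ _ => Finset.sum_nonneg fun _ _ => abs_nonneg _

theorem configNorm1_smul (c : ℝ) (w : Config n d) : configNorm1 (c • w) = |c| * configNorm1 w := by
  simp [configNorm1, abs_mul, Finset.mul_sum]

theorem configNorm1_eq_zero {w : Config n d} (h : configNorm1 w = 0) : w = 0 := by
  ext i j
  have h1 := (Finset.sum_eq_zero_iff_of_nonneg fun i _ =>
    Finset.sum_nonneg fun _ _ => abs_nonneg _).mp h i (Finset.mem_univ i)
  simpa using (Finset.sum_eq_zero_iff_of_nonneg fun _ _ => abs_nonneg _).mp h1 j (Finset.mem_univ j)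

theorem measurable_configNorm1 : Measurable (configNorm1 : Config n d → ℝ) := by
  unfold configNorm1
  simp_rw [← Real.norm_eq_abs]
  fun_prop

theorem abs_configDot_le (w x : Config n d) : |configDot w x| ≤ configNorm1 w * ‖x‖ := by
  unfold configDot configNorm1
  rw [Finset.sum_mul]
  refine (Finset.abs_sum_le_sum_abs _ _).trans (Finset.sum_le_sum fun i _ => ?_)
  exact (abs_dot_le _ _).trans (mul_le_mul_of_nonneg_left (norm_le_pi_norm x i)
    (Finset.sum_nonneg fun _ _ => abs_nonneg _))

theorem measurable_slater_planeWave_uncurry :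
    Measurable fun p : Config n d × Config n d => slater (fun j => planeWave (p.1 j)) p.2 := by
  unfold slater
  simp_rw [Matrix.det_apply']
  refine Measurable.const_mul (Finset.measurable_fun_sum _ fun σ _ => Measurable.const_mul
    (Finset.measurable_fun_prod _ fun i _ => ?_) _) _
  exact measurable_planeWave_uncurry.comp
    (f := fun p : Config n d × Config n d => (p.1 i, p.2 (σ i))) (by fun_prop)

theorem norm_slater_sq (φ : Fin n → (Fin d → ℝ) → ℂ) (x : Config n d) :
    ‖slater φ x‖ ^ 2 = (n.factorial : ℝ)⁻¹ * ‖(Matrix.of fun i j => φ j (x i)).det‖ ^ 2 := by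
  rw [slater, norm_mul, mul_pow, Complex.norm_real, Real.norm_of_nonneg (by positivity), div_pow,
    Real.sq_sqrt (by positivity), one_pow, one_div]

theorem integrable_norm_slater_planeWave_sq (v : Config n d) :
    Integrable (fun x => ‖slater (fun j => planeWave (v j)) x‖ ^ 2) (gaussianConfig n d) := by
  simp_rw [norm_slater_sq]
  exact (IsBoundedFamily.integrable_norm_det_sq ⟨fun j => measurable_planeWave (v j),
    fun j => ⟨1, fun x => (norm_planeWave _ x).le⟩⟩ _).const_mul _

theorem integral_norm_slater_planeWave_sq_le_one (v : Config n d) :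
    ∫ x, ‖slater (fun j => planeWave (v j)) x‖ ^ 2 ∂(gaussianConfig n d) ≤ 1 := by
  simp_rw [norm_slater_sq]
  rw [integral_const_mul, inv_mul_le_one₀ (by positivity)]
  exact integral_norm_det_sq_le_factorial (fun j => measurable_planeWave (v j))
    (fun j x => norm_planeWave (v j) x) _

theorem memLp_norm_pi_gaussianReal (d : ℕ) :
    MemLp (fun x : Fin d → ℝ => ‖x‖) 2 (Measure.pi fun _ => gaussianReal 0 1) := by
  have hsum : MemLp (fun x : Fin d → ℝ => ∑ i, ‖x i‖) 2 (Measure.pi fun _ => gaussianReal 0 1) :=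
    memLp_finsetSum _ fun i _ => ((memLp_id_gaussianReal' (μ := 0) (v := 1) 2
      ENNReal.ofNat_ne_top).comp_measurePreserving
        (measurePreserving_eval (fun _ : Fin d => gaussianReal 0 1) i)).norm
  refine hsum.of_le (by fun_prop) (Eventually.of_forall fun x => ?_)
  rw [norm_norm, Real.norm_of_nonneg (Finset.sum_nonneg fun _ _ => norm_nonneg _),
    pi_norm_le_iff_of_nonneg (Finset.sum_nonneg fun _ _ => norm_nonneg _)]
  exact fun i => Finset.single_le_sum (fun j _ => norm_nonneg (x j)) (Finset.mem_univ i)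

theorem memLp_norm_gaussianConfig (n d : ℕ) :
    MemLp (fun x : Config n d => ‖x‖) 2 (gaussianConfig n d) := by
  have hsum : MemLp (fun x : Config n d => ∑ i, ‖x i‖) 2 (gaussianConfig n d) :=
    memLp_finsetSum _ fun i _ => (memLp_norm_pi_gaussianReal d).comp_measurePreserving
        (measurePreserving_eval (fun _ : Fin n => Measure.pi fun _ : Fin d => gaussianReal 0 1) i)
  refine hsum.of_le (by fun_prop) (Eventually.of_forall fun x => ?_)
  rw [norm_norm, Real.norm_of_nonneg (Finset.sum_nonneg fun _ _ => norm_nonneg _),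
    pi_norm_le_iff_of_nonneg (Finset.sum_nonneg fun _ _ => norm_nonneg _)]
  exact fun i => Finset.single_le_sum (fun j _ => norm_nonneg (x j)) (Finset.mem_univ i)

/-- Column operations on a Slater determinant: all plane waves are close to the one with the
smallest frequency. -/
theorem integral_norm_slater_planeWave_sq_le (v : Config n d) (j₀ : Fin n) {M : ℝ} (hM1 : 1 ≤ M)
    (hM : ∫ y : Fin d → ℝ, ‖y‖ ^ 2 ∂(Measure.pi fun _ => gaussianReal 0 1) ≤ M) :
    ∫ x, ‖slater (fun j => planeWave (v j)) x‖ ^ 2 ∂(gaussianConfig n d) ≤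
      n.factorial * M ^ n *
        (∏ j ∈ Finset.univ.erase j₀, ∑ l, |v j l - v j₀ l|) ^ 2 := by
  set φ : Fin n → (Fin d → ℝ) → ℂ := fun j y =>
    if j = j₀ then planeWave (v j₀) y else planeWave (v j) y - planeWave (v j₀) y with hφ
  have hφb : IsBoundedFamily φ := by
    refine ⟨fun j => ?_, fun j => ⟨2, fun y => ?_⟩⟩
    · by_cases h : j = j₀
      · simpa [hφ, h] using measurable_planeWave (v j₀)
      · simp only [hφ, h, if_false]
        exact (measurable_planeWave (v j)).sub (measurable_planeWave (v j₀))
    · by_cases h : j = j₀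
      · simp [hφ, h, norm_planeWave]
      · simp only [hφ, h, if_false]
        refine (norm_sub_le _ _).trans ?_
        rw [norm_planeWave, norm_planeWave]
        norm_num
  have hdet : ∀ x : Config n d, (Matrix.of fun i j => planeWave (v j) (x i)).det =
      (Matrix.of fun i j => φ j (x i)).det := by
    intro x
    rw [← Matrix.det_transpose, ← Matrix.det_transpose (Matrix.of fun i j => φ j (x i))]
    -- After transposition, every row other than `j₀` gets row `j₀` added back, which leaves the
    -- determinant unchanged.
    refine Matrix.det_eq_of_forall_row_eq_smul_add_const (fun i => if i = j₀ then 0 else 1) j₀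
      (by simp) fun i j => ?_
    by_cases h : i = j₀ <;> simp [hφ, h]
  have hbound : ∀ j, ∫ y, ‖φ j y‖ ^ 2 ∂(Measure.pi fun _ => gaussianReal 0 1) ≤
      M * if j = j₀ then 1 else (∑ l, |v j l - v j₀ l|) ^ 2 := by
    intro j
    by_cases h : j = j₀
    · simpa [hφ, h, norm_planeWave] using hM1
    · simp only [hφ, h, if_false]
      rw [mul_comm]
      refine le_trans ?_ (mul_le_mul_of_nonneg_left hM (sq_nonneg _))
      rw [← integral_const_mul]
      refine integral_mono_of_nonneg (Eventually.of_forall fun _ => by positivity)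
        (((memLp_norm_pi_gaussianReal d).integrable_sq).const_mul _)
        (Eventually.of_forall fun y => ?_)
      simp only
      rw [← mul_pow]
      gcongr
      exact norm_planeWave_sub_le _ _ _
  simp_rw [norm_slater_sq, hdet]
  rw [integral_const_mul]
  calc _ ≤ (n.factorial : ℝ)⁻¹ * ((n.factorial : ℝ) ^ 2 *
        ∏ j, (M * if j = j₀ then 1 else (∑ l, |v j l - v j₀ l|) ^ 2)) := by
        refine mul_le_mul_of_nonneg_left ((hφb.integral_norm_det_sq_le _).trans ?_) (by positivity)
        refine mul_le_mul_of_nonneg_left ?_ (by positivity)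
        exact Finset.prod_le_prod (fun j _ => integral_nonneg fun _ => by positivity)
          fun j _ => hbound j
    _ = _ := by
        rw [Finset.prod_mul_distrib, ← Finset.mul_prod_erase Finset.univ
          (fun j => if j = j₀ then (1 : ℝ) else (∑ l, |v j l - v j₀ l|) ^ 2) (Finset.mem_univ j₀),
          if_pos rfl, one_mul, Finset.prod_congr rfl fun j hj => if_neg (Finset.ne_of_mem_erase hj),
          Finset.prod_pow, Finset.prod_const, Finset.card_univ, Fintype.card_fin]
        have : (n.factorial : ℝ) ≠ 0 := by positivity
        field_simp

/-! ### Decay for slow frequencies -/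

theorem Finset.prod_le_pow_of_sum_le_mul {ι : Type*} (s : Finset ι) (z : ι → ℝ) {a : ℝ}
    (hz : ∀ i ∈ s, 0 ≤ z i) (ha : 0 ≤ a) (h : ∑ i ∈ s, z i ≤ s.card * a) :
    ∏ i ∈ s, z i ≤ a ^ s.card := by
  rcases ha.eq_or_lt with rfl | ha
  · rcases s.eq_empty_or_nonempty with rfl | ⟨i, hi⟩
    · simp
    · rw [mul_zero] at h
      have h0 := (Finset.sum_eq_zero_iff_of_nonneg hz).mp (le_antisymm h (Finset.sum_nonneg hz)) i hi
      rw [Finset.prod_eq_zero hi h0]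
      positivity
  · have := Finset.prod_le_one_of_sum_le_card s (fun i => z i / a)
      (fun i hi => div_nonneg (hz i hi) ha.le)
      (by rw [← Finset.sum_div, div_le_iff₀ ha]; exact h)
    rwa [Finset.prod_div_distrib, Finset.prod_const, div_le_one (by positivity)] at this

/-- Let `j₀` have the smallest frequency in `ℓ¹`. Each difference is then at most twice the norm of
`v j`, so the differences sum to at most twice the total norm, and AM–GM applies to the `N`
remaining factors. -/
theorem exists_prod_sub_le {N : ℕ} (v : Config (N + 1) d) (hN : 1 ≤ N) :
    ∃ j₀, ∏ j ∈ Finset.univ.erase j₀, ∑ l, |v j l - v j₀ l| ≤ (2 * configNorm1 v / N) ^ N := by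
  obtain ⟨j₀, -, hj₀⟩ := Finset.exists_min_image (Finset.univ : Finset (Fin (N + 1)))
    (fun j => ∑ l, |v j l|) Finset.univ_nonempty
  have hNR : (0 : ℝ) < N := by exact_mod_cast hN
  have hcard : (Finset.univ.erase j₀).card = N := by simp
  refine ⟨j₀, ?_⟩
  have hsum : ∑ j ∈ Finset.univ.erase j₀, ∑ l, |v j l| ≤ configNorm1 v :=
    Finset.sum_le_sum_of_subset_of_nonneg (Finset.erase_subset _ _)
      fun _ _ _ => Finset.sum_nonneg fun _ _ => abs_nonneg _
  have h := Finset.prod_le_pow_of_sum_le_mul (Finset.univ.erase j₀)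
    (fun j => ∑ l, |v j l - v j₀ l|) (a := 2 * configNorm1 v / N)
    (fun _ _ => Finset.sum_nonneg fun _ _ => abs_nonneg _)
    (div_nonneg (mul_nonneg zero_le_two (configNorm1_nonneg v)) hNR.le) ?_
  · rwa [hcard] at h
  · rw [hcard, mul_div_cancel₀ _ hNR.ne', two_mul]
    calc ∑ j ∈ Finset.univ.erase j₀, ∑ l, |v j l - v j₀ l|
        ≤ ∑ j ∈ Finset.univ.erase j₀, (∑ l, |v j l| + ∑ l, |v j₀ l|) := by
          refine Finset.sum_le_sum fun j _ => ?_
          rw [← Finset.sum_add_distrib]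
          exact Finset.sum_le_sum fun l _ => abs_sub _ _
      _ ≤ ∑ j ∈ Finset.univ.erase j₀, (∑ l, |v j l| + ∑ l, |v j l|) :=
          Finset.sum_le_sum fun j _ => by
            have := hj₀ j (Finset.mem_univ j)
            linarith
      _ ≤ _ := by
          rw [Finset.sum_add_distrib]
          exact add_le_add hsum hsum

/-- The factor `N^(-2N)` beats the factorial: with `(N+1)! ≤ (N+1) N^N` a power `(4R²M/N)^N ≤
4^(-N)` remains, which absorbs `(N+1) M ≤ 2^N 2^N`. Only four of the `2N` powers of `t / R` are
kept, enough to offset the `1 / s²` in the samples. -/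
theorem factorial_mul_pow_le {N : ℕ} {M R t : ℝ} (hM : 1 ≤ M) (hR : 1 ≤ R) (hN : 2 ≤ N)
    (hNR : 16 * R ^ 2 * M ≤ N) (ht0 : 0 ≤ t) (htR : t ≤ R) :
    ((N + 1).factorial : ℝ) * M ^ (N + 1) * ((2 * t / N) ^ N) ^ 2 ≤ (t ^ 2 / R ^ 2) ^ 2 := by
  have hN0 : (0 : ℝ) < N := by exact_mod_cast (by omega : 0 < N)
  have hR0 : 0 < R := by linarith
  have hMN : M ≤ N := by
    have : 1 ≤ R ^ 2 := one_le_pow₀ hR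
    nlinarith
  have hfac : ((N + 1).factorial : ℝ) ≤ (N + 1) * N ^ N := by
    rw [Nat.factorial_succ]
    push_cast
    gcongr
    exact_mod_cast Nat.factorial_le_pow N
  have hpow : (N : ℝ) + 1 ≤ 2 ^ N := by exact_mod_cast (Nat.lt_two_pow_self : N < 2 ^ N)
  have hq : (t / R) ^ (2 * N) ≤ (t / R) ^ 4 :=
    pow_le_pow_of_le_one (by positivity) ((div_le_one hR0).mpr htR) (by omega)
  have h4 : 4 * R ^ 2 * M / N ≤ 1 / 4 := by
    rw [div_le_div_iff₀ hN0 (by norm_num)]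
    linarith
  calc _ ≤ ((N + 1) * N ^ N : ℝ) * M ^ (N + 1) * ((2 * t / N) ^ N) ^ 2 := by gcongr
    _ = (N + 1) * M * (4 * R ^ 2 * M / N) ^ N * (t / R) ^ (2 * N) := by
        simp only [div_pow, mul_pow, ← pow_mul, pow_succ M N]
        rw [show (4 : ℝ) ^ N = 2 ^ (N * 2) by rw [mul_comm, pow_mul]; norm_num, mul_comm 2 N]
        field_simp
        ring
    _ ≤ 2 ^ N * 2 ^ N * (1 / 4) ^ N * (t / R) ^ 4 := by
        gcongr
        linarith
    _ = _ := by
        rw [← mul_pow, ← mul_pow]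
        norm_num
        rw [div_pow, div_pow]
        ring

/-- Slater determinants of slow plane waves of many particles are tiny. -/
theorem exists_forall_integral_norm_slater_planeWave_sq_le (d : ℕ) {R : ℝ} (hR : 1 ≤ R) :
    ∃ n₀ : ℕ, 3 ≤ n₀ ∧ ∀ n, n₀ ≤ n → ∀ v : Config n d, configNorm1 v ≤ R →
      ∫ x, ‖slater (fun j => planeWave (v j)) x‖ ^ 2 ∂(gaussianConfig n d) ≤
        (configNorm1 v ^ 2 / R ^ 2) ^ 2 := by
  obtain ⟨M, hM1, hM⟩ : ∃ M : ℝ, 1 ≤ M ∧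
      ∫ y : Fin d → ℝ, ‖y‖ ^ 2 ∂(Measure.pi fun _ => gaussianReal 0 1) ≤ M :=
    ⟨max 1 _, le_max_left _ _, le_max_right _ _⟩
  -- With `N = n - 1`, the `+ 3` secures both `N ≥ 16 R² M` and `N ≥ 2`, as well as the `n ≥ 3`
  -- needed to kill linear terms.
  refine ⟨⌈16 * R ^ 2 * M⌉₊ + 3, by omega, fun n hn v hv => ?_⟩
  obtain ⟨N, rfl⟩ : ∃ N, n = N + 1 := ⟨n - 1, by omega⟩
  have hNR : 16 * R ^ 2 * M ≤ N :=
    (Nat.le_ceil _).trans (by exact_mod_cast (by omega : ⌈16 * R ^ 2 * M⌉₊ ≤ N))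
  obtain ⟨j₀, hj₀⟩ := exists_prod_sub_le v (by omega)
  refine (integral_norm_slater_planeWave_sq_le v j₀ hM1 hM).trans (le_trans ?_
    (factorial_mul_pow_le hM1 hR (by omega) hNR (configNorm1_nonneg v) hv))
  gcongr

end PlaneWaves

/-! ### Antisymmetrized neurons as superpositions of Slater determinants -/

section Antisymmetrization

variable {n d : ℕ}

/-- Left multiplication by the transposition reindexes the sum and flips every sign, so the sum
equals its own negative. -/
theorem sum_sign_mul_eq_zero {ι K : Type*} [Fintype ι] [DecidableEq ι] [Field K] [CharZero K]
    {k l : ι} (hkl : k ≠ l) (f : Equiv.Perm ι → K)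
    (hf : ∀ π, f (Equiv.swap k l * π) = f π) :
    ∑ π : Equiv.Perm ι, ((Equiv.Perm.sign π : ℤ) : K) * f π = 0 := by
  have h := Equiv.sum_comp (Equiv.mulLeft (Equiv.swap k l))
    fun π : Equiv.Perm ι => ((Equiv.Perm.sign π : ℤ) : K) * f π
  simp only [Equiv.coe_mulLeft, Equiv.Perm.sign_mul, Equiv.Perm.sign_swap hkl, hf,
    Units.val_neg, neg_mul, one_mul, Int.cast_neg, Finset.sum_neg_distrib] at h
  exact self_eq_neg.mp h.symm

theorem sum_sign_mul_const {ι K : Type*} [Fintype ι] [DecidableEq ι] [Nontrivial ι] [Field K]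
    [CharZero K] (c : K) :
    ∑ π : Equiv.Perm ι, ((Equiv.Perm.sign π : ℤ) : K) * c = 0 := by
  obtain ⟨k, l, hkl⟩ := exists_pair_ne ι
  exact sum_sign_mul_eq_zero hkl _ fun _ => rfl

/-- The `i`-th summand depends on `π` only through `π⁻¹ i`, so it is invariant under swapping two
other indices; these exist exactly when `n ≥ 3`. -/
theorem sum_sign_mul_configDot {K : Type*} [Field K] [CharZero K] [Algebra ℝ K] (hn : 3 ≤ n)
    (w x : Config n d) :
    ∑ π : Equiv.Perm (Fin n), ((Equiv.Perm.sign π : ℤ) : K) *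
      algebraMap ℝ K (configDot w (permConfig π x)) = 0 := by
  simp only [configDot, permConfig, map_sum, Finset.mul_sum]
  rw [Finset.sum_comm]
  refine Finset.sum_eq_zero fun i _ => ?_
  simp_rw [← Finset.mul_sum, ← map_sum]
  obtain ⟨k, hk, l, hl, hkl⟩ : ∃ k ∈ Finset.univ.erase i, ∃ l ∈ Finset.univ.erase i, k ≠ l := by
    refine Finset.one_lt_card.mp ?_
    rw [Finset.card_erase_of_mem (Finset.mem_univ i), Finset.card_univ, Fintype.card_fin]
    omega
  refine sum_sign_mul_eq_zero hkl _ fun π => ?_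
  have : (Equiv.swap k l * π)⁻¹ i = π⁻¹ i := by
    rw [mul_inv_rev, Equiv.swap_inv, Equiv.Perm.mul_apply,
      Equiv.swap_apply_of_ne_of_ne (Finset.ne_of_mem_erase hk).symm (Finset.ne_of_mem_erase hl).symm]
  rw [this]

theorem norm_permConfig_le (π : Equiv.Perm (Fin n)) (x : Config n d) :
    ‖permConfig π x‖ ≤ ‖x‖ :=
  (pi_norm_le_iff_of_nonneg (norm_nonneg x)).mpr fun i => norm_le_pi_norm x (π⁻¹ i)

theorem configDot_smul (c : ℝ) (w x : Config n d) :
    configDot (c • w) x = c * configDot w x := by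
  simp [configDot, Finset.mul_sum, mul_assoc]

/-- The antisymmetrization of a plane wave on configuration space. -/
theorem sum_sign_mul_exp_configDot (w x : Config n d) :
    ∑ π : Equiv.Perm (Fin n), ((Equiv.Perm.sign π : ℤ) : ℂ) *
      Complex.exp (Complex.I * (configDot w (permConfig π x) : ℝ)) =
      (Real.sqrt n.factorial : ℂ) * slater (fun j => planeWave (w j)) x := by
  have hsqrt : (Real.sqrt n.factorial : ℂ) ≠ 0 := by
    exact_mod_cast (Real.sqrt_pos.mpr (by positivity)).ne'
  rw [slater, Complex.ofReal_div, Complex.ofReal_one, one_div, mul_inv_cancel_left₀ hsqrt,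
    Matrix.det_apply', ← Equiv.sum_comp (Equiv.inv (Equiv.Perm (Fin n)))]
  refine Finset.sum_congr rfl fun π _ => ?_
  simp only [Equiv.inv_apply, Equiv.Perm.sign_inv, Matrix.of_apply]
  congr 1
  unfold planeWave
  rw [← Complex.exp_sum, ← Finset.mul_sum]
  simp [configDot, permConfig]

theorem norm_exp_I_mul_sub_one_sub_le (y : ℝ) :
    ‖Complex.exp (Complex.I * y) - 1 - Complex.I * y‖ ≤ 3 * y ^ 2 := by
  have hnorm : ‖Complex.I * (y : ℂ)‖ = |y| := by simp
  rcases le_total |y| 1 with h | h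
  · have := Complex.norm_exp_sub_one_sub_id_le (x := Complex.I * y) (by rwa [hnorm])
    rw [hnorm, sq_abs] at this
    nlinarith [sq_nonneg y]
  · have h1 : ‖Complex.exp (Complex.I * y) - 1 - Complex.I * y‖ ≤ 1 + 1 + |y| := by
      refine (norm_sub_le _ _).trans (add_le_add ((norm_sub_le _ _).trans ?_) hnorm.le)
      rw [Complex.norm_exp_I_mul_ofReal, norm_one]
    nlinarith [sq_abs y]

theorem norm_sign (π : Equiv.Perm (Fin n)) : ‖((Equiv.Perm.sign π : ℤ) : ℂ)‖ = 1 := by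
  rcases Int.units_eq_one_or (Equiv.Perm.sign π) with h | h <;> simp [h]

theorem norm_sqrt_mul_slater_planeWave_le (w x : Config n d) :
    ‖(Real.sqrt n.factorial : ℂ) * slater (fun j => planeWave (w j)) x‖ ≤ n.factorial := by
  rw [← sum_sign_mul_exp_configDot]
  refine (norm_sum_le _ _).trans ?_
  simp only [norm_mul, norm_sign, Complex.norm_exp_I_mul_ofReal, mul_one]
  simp [Fintype.card_perm]

/-- Antisymmetrization removes the Taylor terms of order zero and one, leaving a quadratic
remainder. This makes the singularity `1 / s²` harmless. -/
theorem norm_sqrt_mul_slater_planeWave_le_sq (hn : 3 ≤ n) (w x : Config n d) :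
    ‖(Real.sqrt n.factorial : ℂ) * slater (fun j => planeWave (w j)) x‖ ≤
      n.factorial * (3 * (configNorm1 w * ‖x‖) ^ 2) := by
  have : Nontrivial (Fin n) := Fin.nontrivial_iff_two_le.mpr (by omega)
  have h : (Real.sqrt n.factorial : ℂ) * slater (fun j => planeWave (w j)) x =
      ∑ π : Equiv.Perm (Fin n), ((Equiv.Perm.sign π : ℤ) : ℂ) *
        (Complex.exp (Complex.I * (configDot w (permConfig π x) : ℝ)) - 1 -
          Complex.I * (configDot w (permConfig π x) : ℝ)) := by
    rw [← sum_sign_mul_exp_configDot]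
    have h1 := sum_sign_mul_configDot (K := ℂ) hn w x
    have h2 := sum_sign_mul_const (ι := Fin n) (1 : ℂ)
    simp_rw [mul_sub, Finset.sum_sub_distrib, h2, mul_left_comm _ Complex.I, ← Finset.mul_sum]
    rw [show ∑ π : Equiv.Perm (Fin n), ((Equiv.Perm.sign π : ℤ) : ℂ) *
      ((configDot w (permConfig π x) : ℝ) : ℂ) = 0 from h1]
    simp
  rw [h]
  calc _ ≤ ∑ _π : Equiv.Perm (Fin n), 3 * (configNorm1 w * ‖x‖) ^ 2 := by
        refine (norm_sum_le _ _).trans (Finset.sum_le_sum fun π _ => ?_)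
        rw [norm_mul, norm_sign, one_mul]
        refine (norm_exp_I_mul_sub_one_sub_le _).trans ?_
        rw [← sq_abs]
        gcongr
        exact (abs_configDot_le _ _).trans (mul_le_mul_of_nonneg_left (norm_permConfig_le π x)
          (configNorm1_nonneg w))
    _ = _ := by simp [Fintype.card_perm]

theorem norm_sqrt_mul_slater_planeWave_div_sq_le (hn : 3 ≤ n) {u : Config n d}
    (hu : configNorm1 u ≤ 1) (x : Config n d) (s : ℝ) :
    ‖(Real.sqrt n.factorial : ℂ) * slater (fun j => planeWave ((s • u) j)) x‖ / s ^ 2 ≤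
      n.factorial * (1 + 3 * ‖x‖ ^ 2) * (1 + s ^ 2)⁻¹ := by
  rcases eq_or_ne s 0 with rfl | hs
  · simp
    positivity
  have hs2 : 0 < s ^ 2 := by positivity
  rw [div_le_iff₀ hs2, mul_assoc, inv_mul_eq_div, mul_div_assoc', le_div_iff₀ (by positivity),
    mul_add, mul_one]
  have h1 := norm_sqrt_mul_slater_planeWave_le (s • u) x
  have h2 := norm_sqrt_mul_slater_planeWave_le_sq hn (s • u) x
  have h3 : (configNorm1 (s • u) * ‖x‖) ^ 2 ≤ s ^ 2 * ‖x‖ ^ 2 := by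
    rw [← mul_pow, ← sq_abs (s * ‖x‖), abs_mul, abs_norm, configNorm1_smul]
    have := configNorm1_nonneg u
    gcongr
    exact mul_le_of_le_one_right (abs_nonneg s) hu
  have h4 := mul_le_mul_of_nonneg_right h1 hs2.le
  have h5 : (n.factorial : ℝ) * (3 * (configNorm1 (s • u) * ‖x‖) ^ 2) ≤
      n.factorial * (3 * (s ^ 2 * ‖x‖ ^ 2)) := by gcongr
  nlinarith

/-- `w / ‖w‖₁` -/
noncomputable def unitConfig (w : Config n d) : Config n d := (configNorm1 w)⁻¹ • w

theorem configNorm1_unitConfig_le (w : Config n d) : configNorm1 (unitConfig w) ≤ 1 := by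
  rw [unitConfig, configNorm1_smul, abs_inv, abs_of_nonneg (configNorm1_nonneg w)]
  exact inv_mul_le_one

theorem measurable_unitConfig : Measurable (unitConfig : Config n d → Config n d) :=
  measurable_configNorm1.inv.smul measurable_id

theorem integrable_exp_mul_slater_div_sq (hn : 3 ≤ n) {u : Config n d} (hu : configNorm1 u ≤ 1)
    (c : ℝ) (x : Config n d) :
    Integrable fun s : ℝ => Complex.exp (Complex.I * ((s * c : ℝ) : ℂ)) *
      ((Real.sqrt n.factorial : ℂ) * slater (fun j => planeWave ((s • u) j)) x) / (s : ℂ) ^ 2 := by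
  refine Integrable.mono'
    (integrable_inv_one_add_sq.const_mul (n.factorial * (1 + 3 * ‖x‖ ^ 2))) ?_ ?_
  · have h1 : Measurable fun s : ℝ => slater (fun j => planeWave ((s • u) j)) x :=
      measurable_slater_planeWave_uncurry.comp
        (f := fun s : ℝ => ((s • u : Config n d), x)) (by fun_prop)
    exact Measurable.aestronglyMeasurable (by fun_prop)
  · refine Eventually.of_forall fun s => ?_
    rw [norm_div, norm_mul, Complex.norm_exp_I_mul_ofReal, one_mul, norm_pow, Complex.norm_real,
      Real.norm_eq_abs, sq_abs]
    exact norm_sqrt_mul_slater_planeWave_div_sq_le hn hu x s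

theorem relu_mul_eq {r : ℝ} (hr : 0 ≤ r) (y : ℝ) : relu (r * y) = r * (y + |y|) / 2 := by
  unfold relu
  rcases le_total 0 y with h | h
  · rw [max_eq_right (mul_nonneg hr h), abs_of_nonneg h]
    ring
  · rw [max_eq_left (mul_nonpos_of_nonneg_of_nonpos hr h), abs_of_nonpos h]
    ring

/-- The antisymmetrization of a neuron is a superposition of Slater determinants of plane waves. -/
theorem sum_sign_mul_relu_eq_integral {κ : ℝ}
    (hκ : ∀ y : ℝ, |y| = κ * ∫ s : ℝ, (1 - Real.cos (s * y)) / s ^ 2) (hn : 3 ≤ n)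
    (w x : Config n d) (b : ℝ) :
    ∑ π : Equiv.Perm (Fin n), ((Equiv.Perm.sign π : ℤ) : ℂ) *
        (relu (configDot w (permConfig π x) + b) : ℂ) =
      -((κ / 2 * configNorm1 w : ℝ) : ℂ) *
        ∫ s : ℝ, Complex.exp (Complex.I * ((s * ((configNorm1 w)⁻¹ * b) : ℝ) : ℂ)) *
          ((Real.sqrt n.factorial : ℂ) *
            slater (fun j => planeWave ((s • unitConfig w) j)) x) / (s : ℂ) ^ 2 := by
  have : Nontrivial (Fin n) := Fin.nontrivial_iff_two_le.mpr (by omega)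
  -- For `w = 0` the neuron is constant in `x`, so both sides vanish.
  rcases eq_or_ne (configNorm1 w) 0 with hw | hw
  · have hw0 := configNorm1_eq_zero hw
    have hdot : ∀ y : Config n d, configDot w y = 0 := by simp [hw0, configDot]
    simp only [hdot, zero_add, hw]
    rw [sum_sign_mul_const]
    simp
  set r := configNorm1 w with hr
  have hr0 : 0 < r := (configNorm1_nonneg w).lt_of_ne' hw
  set c := r⁻¹ * b with hc
  set u := unitConfig w with hu
  set z : Equiv.Perm (Fin n) → ℝ := fun π => configDot u (permConfig π x) + c with hz
  set G : ℝ → ℂ := fun s => Complex.exp (Complex.I * ((s * c : ℝ) : ℂ)) *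
          ((Real.sqrt n.factorial : ℂ) * slater (fun j => planeWave ((s • u) j)) x) /
            (s : ℂ) ^ 2 with hG
  have hGint : Integrable G := integrable_exp_mul_slater_div_sq hn (configNorm1_unitConfig_le w) c x
  have hGexp : ∀ s, G s = ∑ π : Equiv.Perm (Fin n), ((Equiv.Perm.sign π : ℤ) : ℂ) *
      Complex.exp (Complex.I * ((s * z π : ℝ) : ℂ)) / (s : ℂ) ^ 2 := by
    intro s
    simp only [hG]
    rw [← sum_sign_mul_exp_configDot, Finset.mul_sum, Finset.sum_div]
    refine Finset.sum_congr rfl fun π _ => ?_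
    rw [mul_left_comm, ← Complex.exp_add, configDot_smul]
    congr 3
    simp only [hz]
    push_cast
    ring
  -- Pairing `s` with `-s` turns exponentials into cosines. The integral of the complex `G` is thus
  -- the real cosine integral, although `G` has an odd sine part.
  have hGeven : ∀ s, G s + G (-s) = ((2 * ∑ π : Equiv.Perm (Fin n),
      ((Equiv.Perm.sign π : ℤ) : ℝ) * Real.cos (s * z π) / s ^ 2 : ℝ) : ℂ) := by
    intro s
    rw [hGexp, hGexp, ← Finset.sum_add_distrib, Finset.mul_sum, Complex.ofReal_sum]
    refine Finset.sum_congr rfl fun π _ => ?_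
    push_cast
    rw [Complex.cos, neg_sq]
    rw [show Complex.I * (-(s : ℂ) * (z π : ℂ)) = -(s * z π) * Complex.I by ring,
      show Complex.I * ((s : ℂ) * (z π : ℂ)) = (s * z π) * Complex.I by ring]
    ring
  have hcosint : ∀ s, ∑ π : Equiv.Perm (Fin n), ((Equiv.Perm.sign π : ℤ) : ℝ) *
      ((1 - Real.cos (s * z π)) / s ^ 2) = -∑ π : Equiv.Perm (Fin n),
      ((Equiv.Perm.sign π : ℤ) : ℝ) * Real.cos (s * z π) / s ^ 2 := by
    intro s
    simp_rw [sub_div, mul_sub, Finset.sum_sub_distrib]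
    rw [sum_sign_mul_const, zero_sub]
    simp_rw [mul_div_assoc]
  have habs : ∑ π : Equiv.Perm (Fin n), ((Equiv.Perm.sign π : ℤ) : ℝ) * |z π| =
      -κ * ∫ s : ℝ, ∑ π : Equiv.Perm (Fin n),
        ((Equiv.Perm.sign π : ℤ) : ℝ) * Real.cos (s * z π) / s ^ 2 := by
    rw [neg_mul, ← mul_neg, ← integral_neg]
    simp_rw [← hcosint]
    rw [integral_finsetSum _ fun π _ => (integrable_one_sub_cos_mul_div_sq (z π)).const_mul _,
      Finset.mul_sum]
    refine Finset.sum_congr rfl fun π _ => ?_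
    rw [hκ, integral_const_mul]
    ring
  have hGval : ∫ s, G s = ((∫ s : ℝ, ∑ π : Equiv.Perm (Fin n),
        ((Equiv.Perm.sign π : ℤ) : ℝ) * Real.cos (s * z π) / s ^ 2 : ℝ) : ℂ) := by
    have h1 : ∫ s, (G s + G (-s)) = 2 * ∫ s, G s := by
      rw [integral_add hGint hGint.comp_neg, integral_neg_eq_self, two_mul]
    simp_rw [hGeven] at h1
    rw [integral_complex_ofReal, integral_const_mul] at h1
    push_cast at h1
    exact (mul_left_cancel₀ two_ne_zero h1).symm
  have hlin : ∑ π : Equiv.Perm (Fin n), ((Equiv.Perm.sign π : ℤ) : ℝ) * z π = 0 := by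
    have h1 := sum_sign_mul_configDot (K := ℝ) hn u x
    simp only [Algebra.algebraMap_self, RingHom.id_apply] at h1
    simp_rw [hz, mul_add, Finset.sum_add_distrib, h1, sum_sign_mul_const, add_zero]
  have hrelu : ∑ π : Equiv.Perm (Fin n), ((Equiv.Perm.sign π : ℤ) : ℝ) *
      relu (configDot w (permConfig π x) + b) =
      r / 2 * ∑ π : Equiv.Perm (Fin n), ((Equiv.Perm.sign π : ℤ) : ℝ) * |z π| := by
    have hpt : ∀ π, relu (configDot w (permConfig π x) + b) = r * (z π + |z π|) / 2 := by
      intro π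
      rw [← relu_mul_eq hr0.le]
      congr 1
      simp only [hz, hu, unitConfig, configDot_smul, hc, ← hr]
      field_simp
    calc _ = r / 2 * (∑ π : Equiv.Perm (Fin n), ((Equiv.Perm.sign π : ℤ) : ℝ) * z π +
          ∑ π : Equiv.Perm (Fin n), ((Equiv.Perm.sign π : ℤ) : ℝ) * |z π|) := by
          rw [← Finset.sum_add_distrib, Finset.mul_sum]
          refine Finset.sum_congr rfl fun π _ => ?_
          rw [hpt]
          ring
      _ = _ := by rw [hlin, zero_add]
  have hcast := congrArg (fun t : ℝ => (t : ℂ)) (hrelu.trans (congrArg (r / 2 * ·) habs))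
  push_cast at hcast
  rw [hcast, hGval]
  push_cast
  ring

end Antisymmetrization

/-! ### Lipschitz bounds and basic facts on Barron functions -/

section Barron

variable {n d : ℕ}

theorem configDot_zero_right (w : Config n d) : configDot w 0 = 0 := by
  simp [configDot]

theorem norm_neuron_sub_neuron_zero_le (p : ℂ × ℝ × Config n d) (x : Config n d) :
    ‖neuron p x - neuron p 0‖ ≤ ‖p.1‖ * configNorm1 p.2.2 * ‖x‖ := by
  rw [neuron, neuron, ← mul_sub, norm_mul, mul_assoc, ← Complex.ofReal_sub, Complex.norm_real,
    configDot_zero_right, zero_add]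
  gcongr
  refine le_trans ?_ (abs_configDot_le p.2.2 x)
  have := abs_max_sub_max_le_abs (configDot p.2.2 x + p.2.1) p.2.1 0
  rw [add_sub_cancel_right] at this
  simpa only [relu, max_comm (0 : ℝ), Real.norm_eq_abs] using this

theorem IsBarronMeasure.enorm_sub_le {ρ : Measure (ℂ × ℝ × Config n d)} {f : Config n d → ℂ}
    (h : IsBarronMeasure ρ f) (x : Config n d) : ‖f x - f 0‖ₑ ≤ barronCost ρ * ‖x‖ₑ := by
  rw [h.eq_integral, h.eq_integral, ← integral_sub (h.integrable x) (h.integrable 0)]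
  refine (enorm_integral_le_lintegral_enorm _).trans ?_
  rw [barronCost, ← lintegral_mul_const' _ _ enorm_ne_top]
  refine lintegral_mono fun p => ?_
  rw [← ofReal_norm, ← ofReal_norm, ← ENNReal.ofReal_mul
    (mul_nonneg (norm_nonneg _) (configNorm1_nonneg _))]
  exact ENNReal.ofReal_le_ofReal (norm_neuron_sub_neuron_zero_le p x)

/-- Barron functions are Lipschitz. -/
theorem enorm_sub_le_barronNorm_mul (f : Config n d → ℂ) (x : Config n d) :
    ‖f x - f 0‖ₑ ≤ barronNorm f * ‖x‖ₑ := by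
  rcases eq_or_ne x 0 with rfl | hx
  · simp
  · have hx0 : ‖x‖ₑ ≠ 0 := by simpa using hx
    rw [← ENNReal.div_le_iff hx0 enorm_ne_top]
    exact le_iInf₂ fun ρ hρ => (ENNReal.div_le_iff hx0 enorm_ne_top).mpr (hρ.enorm_sub_le x)

theorem eLpNorm_const_sub_le (f : Config n d → ℂ) (hf : barronNorm f ≠ ∞) :
    eLpNorm (fun x => f 0 - f x) 2 (gaussianConfig n d) ≤
      barronNorm f * eLpNorm (fun x : Config n d => ‖x‖) 2 (gaussianConfig n d) := by
  have h := eLpNorm_le_nnreal_smul_eLpNorm_of_ae_le_mul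
    (f := fun x => f 0 - f x) (g := fun x : Config n d => ‖x‖) (c := (barronNorm f).toNNReal)
    (μ := gaussianConfig n d) (Eventually.of_forall fun x => ?_) 2
  · rwa [ENNReal.smul_def, smul_eq_mul, ENNReal.coe_toNNReal hf] at h
  · rw [← ENNReal.coe_le_coe, ENNReal.coe_mul, ENNReal.coe_toNNReal hf, nnnorm_norm]
    have := enorm_sub_le_barronNorm_mul f x
    rw [← enorm_neg, neg_sub] at this
    exact this

theorem IsAntisymmetric.apply_zero {ψ : Config n d → ℂ} (hψ : IsAntisymmetric ψ) (hn : 2 ≤ n) :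
    ψ 0 = 0 := by
  have : Nontrivial (Fin n) := Fin.nontrivial_iff_two_le.mpr hn
  obtain ⟨k, l, hkl⟩ := exists_pair_ne (Fin n)
  have h := hψ (Equiv.swap k l) 0
  rw [Equiv.Perm.sign_swap hkl] at h
  have h0 : permConfig (Equiv.swap k l) (0 : Config n d) = 0 := rfl
  rw [h0] at h
  exact self_eq_neg.mp (by simpa using h)

/-- Supplies the trivial approximant. For `n = 1` the zero-frequency wave is the constant `1`; for
`n ≥ 2` a transposition fixes the origin, so `ψ 0 = 0`. -/
theorem IsAntisymmetric.exists_slaterSum_eq_apply_zero {ψ : Config n d → ℂ}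
    (hψ : IsAntisymmetric ψ) (hn : 1 ≤ n) {m : ℕ} (hm : 1 ≤ m) :
    ∃ (μ : Fin m → ℂ) (w : Fin m → Config n d), ∀ x, slaterSum μ w x = ψ 0 := by
  rcases hn.eq_or_lt with rfl | hn
  · refine ⟨fun _ => ψ 0, fun _ => 0, fun x => ?_⟩
    have hmC : (m : ℂ) ≠ 0 := by exact_mod_cast (by omega : m ≠ 0)
    simp [slaterSum, slater, planeWave, hmC]
  · exact ⟨0, 0, fun x => by simp [slaterSum, hψ.apply_zero hn]⟩

/-- The scalar prefactor is absorbed into one column, which does not disturb equivariance of the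
rows. -/
theorem isSumOfDets_slaterSum (hn : 1 ≤ n) {m : ℕ} (μ : Fin m → ℂ) (w : Fin m → Config n d) :
    IsSumOfDets m (slaterSum μ w) := by
  have : NeZero n := ⟨by omega⟩
  set c : Fin m → ℂ := fun k => 1 / (m : ℂ) * (μ k * ((1 / Real.sqrt n.factorial : ℝ) : ℂ)) with hc
  refine ⟨fun k x => Matrix.of fun i j => (if j = 0 then c k else 1) *
    Matrix.of (fun i j => planeWave (w k j) (x i)) i j, fun k π x i j => rfl, fun x => ?_⟩
  rw [slaterSum, Finset.mul_sum]
  refine Finset.sum_congr rfl fun k _ => ?_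
  rw [Matrix.det_mul_row, Finset.prod_ite_eq' Finset.univ (0 : Fin n) fun _ => c k,
    if_pos (Finset.mem_univ _), slater]
  simp only [hc]
  ring

theorem integrable_of_barronCost_ne_top {ρ : Measure (ℂ × ℝ × Config n d)}
    (h : barronCost ρ ≠ ∞) :
    Integrable (fun p : ℂ × ℝ × Config n d => ‖p.1‖ * configNorm1 p.2.2) ρ ∧
      barronCost ρ = ENNReal.ofReal (∫ p, ‖p.1‖ * configNorm1 p.2.2 ∂ρ) := by
  have hm : Measurable fun p : ℂ × ℝ × Config n d => ‖p.1‖ * configNorm1 p.2.2 :=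
    measurable_fst.norm.mul (measurable_configNorm1.comp measurable_snd.snd)
  have h0 : ∀ p : ℂ × ℝ × Config n d, 0 ≤ ‖p.1‖ * configNorm1 p.2.2 := fun p =>
    mul_nonneg (norm_nonneg _) (configNorm1_nonneg _)
  have hint : Integrable (fun p : ℂ × ℝ × Config n d => ‖p.1‖ * configNorm1 p.2.2) ρ := by
    refine ⟨hm.aestronglyMeasurable, ?_⟩
    rw [hasFiniteIntegral_iff_ofReal (Eventually.of_forall h0)]
    exact lt_top_iff_ne_top.mpr h
  exact ⟨hint, (ofReal_integral_eq_lintegral_ofReal hint (Eventually.of_forall h0)).symm⟩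

/-! ### Importance sampling of Slater determinants -/

/-- The random plane-wave Slater determinant attached to a neuron `p` and a frequency `s`,
normalized relative to a Cauchy density of width `R`. -/
noncomputable def slaterSample (R : ℝ) (q : (ℂ × ℝ × Config n d) × ℝ) (x : Config n d) : ℂ :=
  -(q.1.1 / ‖q.1.1‖) *
    Complex.exp (Complex.I * ((q.2 * ((configNorm1 q.1.2.2)⁻¹ * q.1.2.1) : ℝ) : ℂ)) *
    (((R ^ 2 + q.2 ^ 2) / (2 * q.2 ^ 2) : ℝ) : ℂ) *
    slater (fun j => planeWave ((q.2 • unitConfig q.1.2.2) j)) x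

/-- The importance weight that goes with `slaterSample`. -/
noncomputable def sampleWeight (c R : ℝ) (q : (ℂ × ℝ × Config n d) × ℝ) : ℝ :=
  ‖q.1.1‖ * configNorm1 q.1.2.2 * (c * (2 / (R ^ 2 + q.2 ^ 2)))

theorem measurable_slaterSample (R : ℝ) :
    Measurable (Function.uncurry
      (slaterSample R : (ℂ × ℝ × Config n d) × ℝ → Config n d → ℂ)) := by
  have h1 : Measurable fun z : ((ℂ × ℝ × Config n d) × ℝ) × Config n d =>
      slater (fun j => planeWave ((z.1.2 • unitConfig z.1.1.2.2) j)) z.2 := by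
    refine measurable_slater_planeWave_uncurry.comp
      (f := fun z : ((ℂ × ℝ × Config n d) × ℝ) × Config n d =>
        (z.1.2 • unitConfig z.1.1.2.2, z.2)) (Measurable.prodMk ?_ measurable_snd)
    exact (measurable_snd.comp measurable_fst).smul (measurable_unitConfig.comp (by fun_prop))
  have h2 : Measurable fun z : ((ℂ × ℝ × Config n d) × ℝ) × Config n d =>
      configNorm1 z.1.1.2.2 := measurable_configNorm1.comp (by fun_prop)
  unfold Function.uncurry slaterSample
  refine Measurable.mul ?_ h1
  fun_prop

theorem measurable_sampleWeight (c R : ℝ) :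
    Measurable (sampleWeight c R : (ℂ × ℝ × Config n d) × ℝ → ℝ) := by
  have h2 : Measurable fun z : (ℂ × ℝ × Config n d) × ℝ => configNorm1 z.1.2.2 :=
    measurable_configNorm1.comp (by fun_prop)
  unfold sampleWeight
  fun_prop

theorem integral_cauchy {R : ℝ} (hR : 0 < R) :
    Integrable (fun s : ℝ => 2 / (R ^ 2 + s ^ 2)) ∧
      ∫ s : ℝ, 2 / (R ^ 2 + s ^ 2) = 2 * Real.pi / R := by
  have h : ∀ s : ℝ, 2 / (R ^ 2 + s ^ 2) = 2 / R ^ 2 * (1 + (s / R) ^ 2)⁻¹ := by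
    intro s
    have : 0 < R ^ 2 + s ^ 2 := by positivity
    field_simp
  simp_rw [h]
  refine ⟨(integrable_inv_one_add_sq.comp_div hR.ne').const_mul _, ?_⟩
  rw [integral_const_mul, Measure.integral_comp_div (fun s : ℝ => (1 + s ^ 2)⁻¹),
    integral_univ_inv_one_add_sq, smul_eq_mul, abs_of_pos hR]
  field_simp

/-- For `|s| ≥ R` the prefactor is at most `1` and Hadamard's inequality suffices. For `|s| ≤ R` the
decay `s² / R²` of the `L²` norm cancels the `1 / s²` and leaves `(R² + s²) / (2 R²) ≤ 1`. -/
theorem lintegral_enorm_slaterSample_sq_le {R : ℝ} (hR : 0 < R)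
    (hdecay : ∀ v : Config n d, configNorm1 v ≤ R →
      ∫ x, ‖slater (fun j => planeWave (v j)) x‖ ^ 2 ∂(gaussianConfig n d) ≤
        (configNorm1 v ^ 2 / R ^ 2) ^ 2) (q : (ℂ × ℝ × Config n d) × ℝ) :
    ∫⁻ x, ‖slaterSample R q x‖ₑ ^ 2 ∂(gaussianConfig n d) ≤ 1 := by
  obtain ⟨⟨a, b, w⟩, s⟩ := q
  set v := s • unitConfig w with hv
  set t := (R ^ 2 + s ^ 2) / (2 * s ^ 2) with ht
  have ht0 : 0 ≤ t := by positivity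
  -- Not an equality, because the phase `a / ‖a‖` is `0` when `a = 0`.
  have hnorm : ∀ x, ‖slaterSample R ((a, b, w), s) x‖ ≤
      t * ‖slater (fun j => planeWave (v j)) x‖ := by
    intro x
    simp only [slaterSample]
    rw [norm_mul, norm_mul, norm_mul, Complex.norm_exp_I_mul_ofReal, norm_neg, norm_div,
      Complex.norm_real, Complex.norm_real, norm_norm, mul_one, Real.norm_of_nonneg ht0]
    refine mul_le_mul_of_nonneg_right ?_ (norm_nonneg _)
    exact mul_le_of_le_one_left ht0 (div_self_le_one _)
  have hreal : t ^ 2 * ∫ x, ‖slater (fun j => planeWave (v j)) x‖ ^ 2 ∂(gaussianConfig n d) ≤ 1 := by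
    rcases eq_or_ne s 0 with hs | hs
    · simp [ht, hs]
    have hs2 : 0 < s ^ 2 := by positivity
    have hvs : configNorm1 v ≤ |s| := by
      rw [hv, configNorm1_smul]
      exact mul_le_of_le_one_right (abs_nonneg s) (configNorm1_unitConfig_le w)
    rcases le_total |s| R with h | h
    · have hsR : s ^ 2 ≤ R ^ 2 := sq_le_sq' (by linarith [neg_abs_le s]) (by linarith [le_abs_self s])
      calc _ ≤ t ^ 2 * (s ^ 2 / R ^ 2) ^ 2 := by
            refine mul_le_mul_of_nonneg_left ((hdecay v (hvs.trans h)).trans ?_) (sq_nonneg _)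
            have := configNorm1_nonneg v
            rw [← sq_abs s]
            gcongr
        _ = ((R ^ 2 + s ^ 2) / (2 * R ^ 2)) ^ 2 := by
            rw [ht]
            field_simp
        _ ≤ 1 := by
            refine pow_le_one₀ (by positivity) ((div_le_one (by positivity)).mpr (by linarith))
    · have hsR : R ^ 2 ≤ s ^ 2 := by
        rw [← sq_abs s]
        gcongr
      have ht1 : t ≤ 1 := (div_le_one (by positivity)).mpr (by linarith)
      exact mul_le_one₀ (pow_le_one₀ ht0 ht1) (integral_nonneg fun _ => by positivity)
        (integral_norm_slater_planeWave_sq_le_one v)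
  calc _ ≤ ∫⁻ x, ENNReal.ofReal (t ^ 2 * ‖slater (fun j => planeWave (v j)) x‖ ^ 2)
        ∂(gaussianConfig n d) := by
        refine lintegral_mono fun x => ?_
        rw [← ofReal_norm, ← ENNReal.ofReal_pow (norm_nonneg _), ← mul_pow]
        exact ENNReal.ofReal_le_ofReal (pow_le_pow_left₀ (norm_nonneg _) (hnorm x) 2)
    _ = ENNReal.ofReal (t ^ 2 * ∫ x, ‖slater (fun j => planeWave (v j)) x‖ ^ 2
        ∂(gaussianConfig n d)) := by
        rw [← integral_const_mul, ofReal_integral_eq_lintegral_ofReal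
          ((integrable_norm_slater_planeWave_sq v).const_mul _)
          (Eventually.of_forall fun x => by positivity)]
    _ ≤ 1 := ENNReal.ofReal_le_one.mpr hreal

/-- The Cauchy factors cancel to `1 / s²`, so the product is independent of `R`. This leaves `R`
free to tune the total mass. -/
theorem sampleWeight_mul_slaterSample {c R : ℝ} (hR : 0 < R)
    (p : ℂ × ℝ × Config n d) (s : ℝ) (x : Config n d) :
    (sampleWeight c R (p, s) : ℂ) * slaterSample R (p, s) x =
      -(p.1 * (c / Real.sqrt n.factorial * configNorm1 p.2.2 : ℝ)) *
        (Complex.exp (Complex.I * ((s * ((configNorm1 p.2.2)⁻¹ * p.2.1) : ℝ) : ℂ)) *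
          ((Real.sqrt n.factorial : ℂ) *
            slater (fun j => planeWave ((s • unitConfig p.2.2) j)) x) / (s : ℂ) ^ 2) := by
  have hsqrt : (Real.sqrt n.factorial : ℂ) ≠ 0 := by
    exact_mod_cast (Real.sqrt_pos.mpr (by positivity)).ne'
  have ha : (‖p.1‖ : ℂ) * (p.1 / ‖p.1‖) = p.1 := by
    rcases eq_or_ne p.1 0 with h | h
    · simp [h]
    · exact mul_div_cancel₀ _ (by exact_mod_cast norm_ne_zero_iff.mpr h)
  have hq : ((2 / (R ^ 2 + s ^ 2) : ℝ) : ℂ) * (((R ^ 2 + s ^ 2) / (2 * s ^ 2) : ℝ) : ℂ) =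
      ((s : ℂ) ^ 2)⁻¹ := by
    have : R ^ 2 + s ^ 2 ≠ 0 := by positivity
    rw [← Complex.ofReal_mul, div_mul_div_cancel₀ this, div_mul_cancel_left₀ two_ne_zero]
    push_cast
    rfl
  simp only [sampleWeight, slaterSample]
  set E := Complex.exp (Complex.I * ((s * ((configNorm1 p.2.2)⁻¹ * p.2.1) : ℝ) : ℂ))
  set D := slater (fun j => planeWave ((s • unitConfig p.2.2) j)) x
  calc _ = -((‖p.1‖ : ℂ) * (p.1 / ‖p.1‖)) * (c * configNorm1 p.2.2) * E * D *
        (((2 / (R ^ 2 + s ^ 2) : ℝ) : ℂ) * (((R ^ 2 + s ^ 2) / (2 * s ^ 2) : ℝ) : ℂ)) := by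
        push_cast
        ring
    _ = _ := by
        rw [ha, hq]
        push_cast
        field_simp

theorem integrable_sampleWeight_mul_slaterSample {ρ : Measure (ℂ × ℝ × Config n d)} [SFinite ρ]
    (hρ : Integrable (fun p : ℂ × ℝ × Config n d => ‖p.1‖ * configNorm1 p.2.2) ρ)
    {c R : ℝ} (hc : 0 ≤ c) (hR : 0 < R) (hn : 3 ≤ n) (x : Config n d) :
    Integrable (fun q => (sampleWeight c R q : ℂ) * slaterSample R q x) (ρ.prod volume) := by
  refine Integrable.mono' (hρ.mul_prod (integrable_inv_one_add_sq.const_mul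
    (c / Real.sqrt n.factorial * (n.factorial * (1 + 3 * ‖x‖ ^ 2))))) ?_ ?_
  · exact ((Complex.measurable_ofReal.comp (measurable_sampleWeight c R)).mul
      ((measurable_slaterSample R).comp measurable_prodMk_right)).aestronglyMeasurable
  · refine Eventually.of_forall fun ⟨p, s⟩ => ?_
    have h0 := configNorm1_nonneg p.2.2
    rw [sampleWeight_mul_slaterSample hR, norm_mul, norm_neg, norm_mul, norm_div, norm_mul,
      Complex.norm_exp_I_mul_ofReal, one_mul, norm_pow, Complex.norm_real, Complex.norm_real,
      Real.norm_eq_abs s, sq_abs, Real.norm_of_nonneg (by positivity)]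
    have := norm_sqrt_mul_slater_planeWave_div_sq_le hn (configNorm1_unitConfig_le p.2.2) x s
    calc _ ≤ ‖p.1‖ * (c / Real.sqrt n.factorial * configNorm1 p.2.2) *
          (n.factorial * (1 + 3 * ‖x‖ ^ 2) * (1 + s ^ 2)⁻¹) := by gcongr
      _ = _ := by ring

/-- An antisymmetric Barron function is a superposition of Slater determinants of plane waves. -/
theorem IsAntisymmetric.eq_integral_slaterSample {ψ : Config n d → ℂ} (hψ : IsAntisymmetric ψ)
    {ρ : Measure (ℂ × ℝ × Config n d)} (hρ : IsBarronMeasure ρ ψ)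
    (hρint : Integrable (fun p : ℂ × ℝ × Config n d => ‖p.1‖ * configNorm1 p.2.2) ρ)
    {κ R : ℝ} (hκ0 : 0 < κ)
    (hκ : ∀ y : ℝ, |y| = κ * ∫ s : ℝ, (1 - Real.cos (s * y)) / s ^ 2) (hR : 0 < R) (hn : 3 ≤ n)
    (x : Config n d) :
    ψ x = ∫ q, (sampleWeight (κ / (2 * Real.sqrt n.factorial)) R q : ℂ) * slaterSample R q x
      ∂(ρ.prod volume) := by
  have := hρ.finite
  have hfac : (n.factorial : ℂ) ≠ 0 := by exact_mod_cast n.factorial_ne_zero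
  have hsign : ∀ π : Equiv.Perm (Fin n),
      ((Equiv.Perm.sign π : ℤ) : ℂ) * ψ (permConfig π x) = ψ x := by
    intro π
    rw [hψ, ← mul_assoc]
    rcases Int.units_eq_one_or (Equiv.Perm.sign π) with h | h <;> simp [h]
  -- `ψ` is the average of its own signed permutations, so each neuron may be replaced by its
  -- antisymmetrization.
  have hsum : (n.factorial : ℂ) * ψ x =
      ∑ π : Equiv.Perm (Fin n), ((Equiv.Perm.sign π : ℤ) : ℂ) * ψ (permConfig π x) := by
    simp [hsign, Fintype.card_perm]
  apply mul_left_cancel₀ hfac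
  rw [hsum, integral_prod _ (integrable_sampleWeight_mul_slaterSample hρint (by positivity) hR hn x),
    ← integral_const_mul]
  simp_rw [hρ.eq_integral, ← integral_const_mul]
  rw [← integral_finsetSum _ fun π _ => (hρ.integrable _).const_mul _]
  congr 1 with p
  simp_rw [sampleWeight_mul_slaterSample hR, neuron]
  rw [integral_const_mul, integral_const_mul]
  have h := sum_sign_mul_relu_eq_integral hκ hn p.2.2 x p.2.1
  simp_rw [mul_left_comm _ p.1, ← Finset.mul_sum]
  rw [h]
  have hsq : (n.factorial : ℂ) = (Real.sqrt n.factorial : ℂ) * (Real.sqrt n.factorial : ℂ) := by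
    rw [← Complex.ofReal_mul, Real.mul_self_sqrt (by positivity), Complex.ofReal_natCast]
  have hsqrt : (Real.sqrt n.factorial : ℂ) ≠ 0 := by
    exact_mod_cast (Real.sqrt_pos.mpr (by positivity)).ne'
  rw [hsq]
  generalize (∫ s : ℝ, Complex.exp (Complex.I * ((s * ((configNorm1 p.2.2)⁻¹ * p.2.1) : ℝ) : ℂ)) *
    ((Real.sqrt n.factorial : ℂ) *
      slater (fun j => planeWave ((s • unitConfig p.2.2) j)) x) / (s : ℂ) ^ 2) = I
  push_cast
  field_simp

instance isProbabilityMeasure_gaussianConfig : IsProbabilityMeasure (gaussianConfig n d) := by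
  unfold gaussianConfig
  infer_instance

theorem exists_forall_slaterSum_approx (d : ℕ) (hd : 1 ≤ d) :
    ∃ n₀ : ℕ, ∀ n, n₀ ≤ n → ∀ ψ : Config n d → ℂ, IsAntisymmetric ψ →
      barronNorm ψ ≠ 0 → barronNorm ψ ≠ ∞ → ∀ m : ℕ, 1 ≤ m →
        ∃ (μ : Fin m → ℂ) (w : Fin m → Config n d),
          eLpNorm (fun x => slaterSum μ w x - ψ x) 2 (gaussianConfig n d) ≤
            barronNorm ψ / ENNReal.ofReal (Real.sqrt (Nat.factorial n : ℝ)) *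
              ENNReal.ofReal ((2 * Real.sqrt (d : ℝ) / Real.pi) / Real.sqrt (m : ℝ)) := by
  obtain ⟨κ, hκ0, hκ⟩ := exists_abs_eq_integral_cos
  -- Chosen so that the total sampling mass is at most `2 / π` times `‖ψ‖_B / √(n!)`, even for a `ρ`
  -- of twice the minimal cost. It is independent of `n`, hence so is `n₀`.
  set R : ℝ := max 1 (Real.pi ^ 2 * κ) with hRdef
  have hR1 : 1 ≤ R := le_max_left _ _
  have hR : 0 < R := by linarith
  obtain ⟨n₀, hn₀, hdecay⟩ := exists_forall_integral_norm_slater_planeWave_sq_le d hR1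
  refine ⟨n₀, fun n hn ψ hψ hB0 hBtop m hm => ?_⟩
  have hn3 : 3 ≤ n := hn₀.trans hn
  -- The infimum need not be attained. A factor of `2` is available because the norm is positive and
  -- finite, and `R` compensates for it.
  obtain ⟨ρ, hρ, hcost⟩ : ∃ ρ, ∃ _ : IsBarronMeasure ρ ψ, barronCost ρ < 2 * barronNorm ψ := by
    have : barronNorm ψ < 2 * barronNorm ψ := by
      rw [two_mul]
      exact ENNReal.lt_add_right hBtop hB0
    conv_lhs at this => rw [barronNorm]
    simpa only [iInf_lt_iff] using this
  have := hρ.finite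
  obtain ⟨hint, hcosteq⟩ := integrable_of_barronCost_ne_top hcost.ne_top
  set K := ∫ p, ‖p.1‖ * configNorm1 p.2.2 ∂ρ with hK
  set B := (barronNorm ψ).toReal with hBdef
  have hBeq : barronNorm ψ = ENNReal.ofReal B := (ENNReal.ofReal_toReal hBtop).symm
  have hBpos : 0 < B := ENNReal.toReal_pos hB0 hBtop
  have hBK : B ≤ K := by
    have h : barronNorm ψ ≤ barronCost ρ := iInf₂_le ρ hρ
    rw [hBeq, hcosteq] at h
    by_contra! hlt
    exact absurd h (not_le.mpr ((ENNReal.ofReal_lt_ofReal_iff hBpos).mpr hlt))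
  have hKB : K ≤ 2 * B := by
    have h := hcost.le
    rw [hBeq, hcosteq, ← ENNReal.ofReal_ofNat, ← ENNReal.ofReal_mul zero_le_two] at h
    exact (ENNReal.ofReal_le_ofReal_iff (by positivity)).mp h
  set N := Real.sqrt n.factorial with hN
  have hNpos : 0 < N := Real.sqrt_pos.mpr (by positivity)
  set c := κ / (2 * N) with hc
  have hc0 : 0 < c := by positivity
  obtain ⟨hcauchy, hcauchyval⟩ := integral_cauchy hR
  have hβint : Integrable (sampleWeight c R : (ℂ × ℝ × Config n d) × ℝ → ℝ) (ρ.prod volume) :=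
    hint.mul_prod (hcauchy.const_mul c)
  have hβval : ∫ q, sampleWeight c R q ∂(ρ.prod volume) = K * (c * (2 * Real.pi / R)) := by
    have := integral_prod_mul (μ := ρ) (ν := volume)
      (fun p : ℂ × ℝ × Config n d => ‖p.1‖ * configNorm1 p.2.2)
      (fun s : ℝ => c * (2 / (R ^ 2 + s ^ 2)))
    rw [integral_const_mul, hcauchyval] at this
    exact this
  have hWpos : 0 < ∫ q, sampleWeight c R q ∂(ρ.prod volume) := by
    rw [hβval]
    have : 0 < K := hBpos.trans_le hBK
    have := Real.pi_pos
    positivity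
  obtain ⟨ω, hω⟩ := exists_weighted_sample_eLpNorm_le (ρ.prod volume) (gaussianConfig n d)
    (measurable_sampleWeight c R)
    (fun q => mul_nonneg (mul_nonneg (norm_nonneg _) (configNorm1_nonneg _)) (by positivity))
    hβint hWpos (measurable_slaterSample R)
    (fun x => integrable_sampleWeight_mul_slaterSample hint hc0.le hR hn3 x)
    (lintegral_enorm_slaterSample_sq_le hR (hdecay n hn)) m hm
  set W := ∫ q, sampleWeight c R q ∂(ρ.prod volume) with hW
  refine ⟨fun k => W * (-((ω k).1.1 / ‖(ω k).1.1‖) *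
    Complex.exp (Complex.I * (((ω k).2 * ((configNorm1 (ω k).1.2.2)⁻¹ * (ω k).1.2.1) : ℝ) : ℂ)) *
    (((R ^ 2 + (ω k).2 ^ 2) / (2 * (ω k).2 ^ 2) : ℝ) : ℂ)),
    fun k => (ω k).2 • unitConfig (ω k).1.2.2, ?_⟩
  have hfun : ∀ x, slaterSum (fun k => W * (-((ω k).1.1 / ‖(ω k).1.1‖) *
    Complex.exp (Complex.I * (((ω k).2 * ((configNorm1 (ω k).1.2.2)⁻¹ * (ω k).1.2.1) : ℝ) : ℂ)) *
    (((R ^ 2 + (ω k).2 ^ 2) / (2 * (ω k).2 ^ 2) : ℝ) : ℂ)))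
    (fun k => (ω k).2 • unitConfig (ω k).1.2.2) x - ψ x =
      1 / (m : ℂ) * ∑ k, (W : ℂ) * slaterSample R (ω k) x -
        ∫ q, (sampleWeight c R q : ℂ) * slaterSample R q x ∂(ρ.prod volume) := by
    intro x
    rw [← hψ.eq_integral_slaterSample hρ hint hκ0 hκ hR hn3 x, slaterSum]
    simp only [slaterSample, mul_assoc]
  simp_rw [hfun]
  refine hω.trans ?_
  rw [hBeq, ← ENNReal.ofReal_div_of_pos hNpos, ← ENNReal.ofReal_mul (by positivity)]
  refine ENNReal.ofReal_le_ofReal ?_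
  rw [← mul_div_assoc]
  gcongr
  have hd1 : 1 ≤ Real.sqrt d := Real.one_le_sqrt.mpr (by exact_mod_cast hd)
  have hpi := Real.pi_pos
  have hRκ : Real.pi ^ 2 * κ ≤ R := le_max_right _ _
  calc W = K * (c * (2 * Real.pi / R)) := hβval
    _ ≤ 2 * B * (c * (2 * Real.pi / R)) := by gcongr
    _ = B / N * (2 * (Real.pi ^ 2 * κ / R) / Real.pi) := by
        rw [hc]
        field_simp
    _ ≤ B / N * (2 * Real.sqrt d / Real.pi) := by
        gcongr
        exact ((div_le_one hR).mpr hRκ).trans hd1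

end Barron

/-! ### The main theorem: large and small particle numbers -/

/-- For each `d`, `g n` stands for the quantity `Ω(n)`: it depends on nothing but `d` and `n`. -/
theorem theorem1 (d : ℕ) (hd : 1 ≤ d) :
    ∃ g : ℕ → ℝ, (∃ c : ℝ, 0 < c ∧ ∀ᶠ n : ℕ in atTop, c * (n : ℝ) ≤ g n) ∧
      ∀ (n : ℕ), 1 ≤ n →
      ∀ (ψ : Config n d → ℂ), IsAntisymmetric ψ → IsBarron ψ →
      ∀ (m : ℕ), 1 ≤ m →
        ∃ (μ : Fin m → ℂ) (w : Fin m → Config n d),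
          eLpNorm (fun x => slaterSum μ w x - ψ x) 2 (gaussianConfig n d) ≤
            barronNorm ψ / ENNReal.ofReal (Real.sqrt (Nat.factorial n : ℝ)) *
              ENNReal.ofReal
                ((2 * Real.sqrt (d : ℝ) / Real.pi) / Real.sqrt (m : ℝ) + (2 : ℝ) ^ (-(g n))) ∧
          eLpNorm (fun x => slaterSum μ w x - ψ x) 2 (gaussianConfig n d) ≤
            antisymBarronNorm ψ *
              ENNReal.ofReal
                ((2 * Real.sqrt (d : ℝ) / Real.pi) / Real.sqrt (m : ℝ) + (2 : ℝ) ^ (-(g n))) ∧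
          IsSumOfDets m (slaterSum μ w) := by
  obtain ⟨n₀, hn₀⟩ := exists_forall_slaterSum_approx d hd
  set M : ℕ → ℝ := fun n =>
    (eLpNorm (fun x : Config n d => ‖x‖) 2 (gaussianConfig n d)).toReal with hM
  set A : ℕ → ℝ := fun n => Real.sqrt n.factorial * (M n + 1) with hA
  have hApos : ∀ n, 0 < A n := fun n =>
    mul_pos (Real.sqrt_pos.mpr (by positivity))
      (by linarith [(ENNReal.toReal_nonneg : 0 ≤ M n)])
  -- For the finitely many `n < n₀`, `2 ^ (-g n) = A n` is large enough to cover the crude Lipschitz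
  -- error, the factor `√(n!)` in `A n` undoing the normalization. From `n₀` on, the Monte Carlo
  -- term alone suffices and `2 ^ (-n)` is slack.
  refine ⟨fun n => if n < n₀ then -Real.logb 2 (A n) else n, ⟨1, one_pos, ?_⟩, ?_⟩
  · filter_upwards [eventually_ge_atTop n₀] with n hn
    rw [if_neg (by omega), one_mul]
  intro n hn ψ hψ _ m hm
  suffices h : ∃ (μ : Fin m → ℂ) (w : Fin m → Config n d),
      eLpNorm (fun x => slaterSum μ w x - ψ x) 2 (gaussianConfig n d) ≤
        barronNorm ψ / ENNReal.ofReal (Real.sqrt (Nat.factorial n : ℝ)) *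
          ENNReal.ofReal ((2 * Real.sqrt (d : ℝ) / Real.pi) / Real.sqrt (m : ℝ) +
            (2 : ℝ) ^ (-(if n < n₀ then -Real.logb 2 (A n) else (n : ℝ)))) by
    obtain ⟨μ, w, h⟩ := h
    exact ⟨μ, w, h, h, isSumOfDets_slaterSum hn μ w⟩
  have hC0 : 0 ≤ (2 * Real.sqrt (d : ℝ) / Real.pi) / Real.sqrt (m : ℝ) := by
    have := Real.pi_pos
    positivity
  by_cases hBtop : barronNorm ψ = ∞
  · refine ⟨0, 0, ?_⟩
    rw [hBtop, ENNReal.top_div_of_ne_top ENNReal.ofReal_ne_top, ENNReal.top_mul]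
    · exact le_top
    · exact (ENNReal.ofReal_pos.mpr (by positivity)).ne'
  obtain ⟨μ, w, hμw⟩ := hψ.exists_slaterSum_eq_apply_zero hn hm
  have hcrude := eLpNorm_const_sub_le ψ hBtop
  -- A Barron function of norm zero equals the constant `ψ 0`, by the Lipschitz bound. It is treated
  -- apart because no measure of cost below twice the norm exists then.
  by_cases hB0 : barronNorm ψ = 0
  · refine ⟨μ, w, ?_⟩
    simp_rw [hμw]
    rw [hB0, zero_mul] at hcrude
    exact hcrude.trans zero_le
  by_cases hnn : n < n₀
  · refine ⟨μ, w, ?_⟩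
    simp_rw [hμw]
    refine hcrude.trans ?_
    rw [if_pos hnn, neg_neg, Real.rpow_logb two_pos (by norm_num) (hApos n)]
    have hsqrt : 0 < Real.sqrt n.factorial := Real.sqrt_pos.mpr (by positivity)
    calc _ = barronNorm ψ * ENNReal.ofReal (M n) := by
          rw [hM, ENNReal.ofReal_toReal (memLp_norm_gaussianConfig n d).eLpNorm_ne_top]
      _ ≤ barronNorm ψ * ENNReal.ofReal (A n / Real.sqrt n.factorial) := by
          gcongr
          rw [hA, mul_div_cancel_left₀ _ hsqrt.ne']
          linarith
      _ = barronNorm ψ / ENNReal.ofReal (Real.sqrt n.factorial) * ENNReal.ofReal (A n) := by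
          rw [ENNReal.ofReal_div_of_pos hsqrt, div_eq_mul_inv, div_eq_mul_inv, mul_assoc,
            mul_comm (ENNReal.ofReal (A n))]
      _ ≤ _ := by
          gcongr
          linarith
  · obtain ⟨μ, w, h⟩ := hn₀ n (by omega) ψ hψ hB0 hBtop m hm
    refine ⟨μ, w, h.trans ?_⟩
    gcongr
    exact le_add_of_nonneg_right (by positivity)
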